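/- **Parameters.** Fix $\log q,\log d\in\mathbb C$, put $q=e^{\log q}$, $d=e^{\log d}$, $q_1=q^{-1}d$, $q_2=q^2$, $q_3=q^{-1}d^{-1}$, and assume that $q,d$ are generic: for $a,b\in\mathbb Q$, $q^ad^b=1$ if and only if $a=b=0$. **The algebra.** For $i,j\in\mathbb Z/2\mathbb Z$ let $g_{i,j}(z,w)=z-q_2w$ if $i=j$ and $g_{i,j}(z,w)=(z-q_1w)(z-q_3w)$ if $i\ne j$; let $[A,B]_p=AB-pBA$ and $\delta(z)=\sum_{k\in\mathbb Z}z^k$. The quantum toroidal algebra $\mathcal E$ of type $\mathfrak{gl}_2$ is the unital associative $\mathbb C$-algebra with generators $E_{i,k},F_{i,k},H_{i,r},K_i^{\pm1},\mathsf t^{\pm1}$ ($i\in\mathbb Z/2\mathbb Z$, $k\in\mathbb Z$, $r\in\mathbb Z\setminus\{0\}$), where $\mathsf t$ is central, and with the following relations in terms of $E_i(z)=\sum_kE_{i,k}z^{-k}$, $F_i(z)=\sum_kF_{i,k}z^{-k}$, $K_i^\pm(z)=K_i^{\pm1}\exp\bigl(\pm(q-q^{-1})\sum_{r>0}H_{i,\pm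 r}z^{\mp r}\bigr)$: all coefficients of all $K_i^\pm(z)$ commute with each other, and $$(-1)^{i+j}g_{i,j}(z,w)K_i^\pm(z)E_j(w)+g_{j,i}(w,z)E_j(w)K_i^\pm(z)=0,$$ $$(-1)^{i+j}g_{j,i}(w,z)K_i^\pm(z)F_j(w)+g_{i,j}(z,w)F_j(w)K_i^\pm(z)=0,$$ $$[E_i(z),F_j(w)]=\tfrac{\delta_{i,j}}{q-q^{-1}}\,\delta(z/w)\,(K_i^+(w)-K_i^-(z)),$$ $$(-1)^{i+j}g_{i,j}(z,w)E_i(z)E_j(w)+g_{j,i}(w,z)E_j(w)E_i(z)=0,$$ $$(-1)^{i+j}g_{j,i}(w,z)F_i(z)F_j(w)+g_{i,j}(z,w)F_j(w)F_i(z)=0,$$ $$\mathrm{Sym}_{z_1,z_2,z_3}[E_i(z_1),[E_i(z_2),[E_i(z_3),E_{i+1}(w)]_{q^2}]]_{q^{-2}}=0,$$ and the same last relation with $F$ in place of $E$. An $\mathcal E$-module has level $\kappa$ if $K_0K_1$ acts as the scalar $\kappa$. It is tame if it has a basis of vectors $v$ with $K_i^\pm(z)v=\phi^i(z)v$, $i=0,1$,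 where $\phi=(\phi^0,\phi^1)$ is a pair of rational functions (expanded at $z=\infty$ for $+$ and at $z=0$ for $-$), such that distinct basis vectors have distinct pairs $\phi$. **Combinatorial data.** A rational function $f$ is balanced if it is regular at $0$ and $\infty$ and $f(0)f(\infty)=1$. For $a\in\mathbb C^\times$ put $$0_a=\Bigl(\tfrac{qz-a}{z-aq},1\Bigr),\quad 1_a=\Bigl(1,\tfrac{qz-a}{z-aq}\Bigr),\quad A_{i,a}=i_{q^{-1}a}\,i_{qa}\,(i+1)^{-1}_{q_1qa}\,(i+1)^{-1}_{q_3qa}.$$ Consider a totally ordered set of boxes; each box has coordinates $(x,y,z)\in\mathbb C^3$, a color $c(\Box)\in\mathbb Z/2\mathbb Z$, position $p(\Box)=q_1^{-x}q_2^{-y}q_3^{-z}$, and is either positive or negative. Boxes at the same position have the same color; boxes whose coordinates differ by integers are ordered lexicographically according to $y>z>x$; if the $x$- and $z$-coordinates of two boxes differ by integers, their colors differ by the sum of these two integers mod $2$. A state $\lambda=\lambda^+\sqcup\lambda^-$ is a finite set $\lambda^+$ of positive boxes together with a finite set $\lambda^-$ of negative boxes. Let $S$ be a set of states containing $\emptyset$,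 and let $\Psi$ be a pair of balanced rational functions. Adding a box to $\lambda$ means putting a positive box $\Box\notin\lambda^+$ into $\lambda^+$ or taking a negative box $\Box\in\lambda^-$ out of $\lambda^-$; removing a box means taking a positive box out of $\lambda^+$ or putting a negative box $\Box\notin\lambda^-$ into $\lambda^-$. The results are denoted $\lambda\sqcup\Box$ and $\lambda\setminus\Box$. Let $CC_i(\lambda)$ (concave boxes), resp. $CV_i(\lambda)$ (convex boxes), be the set of boxes of color $i$ which can be added to, resp. removed from, $\lambda\in S$ so that the result is in $S$. The $\ell$-weight of a box $\Box$ in $\lambda$ is $A^{-1}_{c(\Box),p(\Box)}$ if $\Box\in\lambda^+$ and $A_{c(\Box),p(\Box)}$ if $\Box\in\lambda^-$. Let $\phi_\lambda$ be the product of $\Psi$ and of the $\ell$-weights of all boxes in $\lambda$. Let $\phi_{\lambda,<\Box}$, resp. $\phi_{\lambda,>\Box}$, be the product of the $\ell$-weights of the boxes of $\lambda$ which are smaller, resp. larger, than $\Box$, where the factor $\Psi$ is included in $\phi_{\lambda,<\Box}$ if $\Box$ is positive and in $\phi_{\lambda,>\Box}$ if $\Box$ is negative. The data are admissible if every state of $S$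 can be connected to $\emptyset$ inside $S$ by taking boxes out of $\lambda^+$ or $\lambda^-$ one by one, and for all $\lambda\in S$, $i\in\{0,1\}$: (A1) the $\phi_\lambda$ are pairwise distinct; (A2) $\phi^i_\lambda$ is balanced with only simple poles; (A3) $\Box\mapsto p(\Box)$ is a bijection from $CC_i(\lambda)\sqcup CV_i(\lambda)$ to the set of poles of $\phi_\lambda^i$; (A4) for $\Box\in CC_i(\lambda)\sqcup CV_i(\lambda)$, $\phi^i_{\lambda,>\Box}$ is regular at $p(\Box)$ if $\Box$ is positive, and $\phi^i_{\lambda,<\Box}$ is regular at $p(\Box)$ if $\Box$ is negative; (A5) if $(x,y,z)$ is concave in $\lambda$, then a box which is concave in $\lambda\sqcup(x,y,z)$ but not in $\lambda$ has coordinates $(x,y,z+1)$, $(x,y+1,z)$ or $(x+1,y,z)$, and a box which is convex in $\lambda$ but not in $\lambda\sqcup(x,y,z)$ has coordinates $(x,y,z)$, $(x,y,z-1)$, $(x,y-1,z)$ or $(x-1,y,z)$. On the vector space $V(S,\Psi)=\bigoplus_{\lambda\in S}\mathbb C|\lambda\rangle$ consider the formulas $$K_i^\pm(z)|\lambda\rangle=\phi_\lambda^i(z)|\lambda\rangle,\quad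 F_i(z)|\lambda\rangle=\sum_{\Box\in CC_i(\lambda)}a^i_{\lambda,\Box}\,\delta(z/p(\Box))\,|\lambda\sqcup\Box\rangle,\quad E_i(z)|\lambda\rangle=\sum_{\Box\in CV_i(\lambda)}b^i_{\lambda,\Box}\,\delta(z/p(\Box))\,|\lambda\setminus\Box\rangle,\quad \mathsf t=1,\qquad(*)$$ where $a^i_{\lambda,\Box}=\phi^i_{\lambda,>\Box}(p(\Box))$ and $b^i_{\lambda,\Box}=\frac{1}{q-q^{-1}}\operatorname{res}_{z=p(\Box)}\phi^i_{\lambda,<\Box}(z)\frac{dz}{z}$ if $\Box$ is positive, and $a^i_{\lambda,\Box}=\frac{-1}{q-q^{-1}}\operatorname{res}_{z=p(\Box)}\phi^i_{\lambda,>\Box}(z)\frac{dz}{z}$ and $b^i_{\lambda,\Box}=\phi^i_{\lambda,<\Box}(p(\Box))$ if $\Box$ is negative. **Proposition (vector module of color $0$).** Let $\Psi(U_0)=0_{q^{-1}}1^{-1}_{qq_1}$. Let the boxes be $(i,0,0)$, $i\in\mathbb Z$, with color $i$ mod $2$, ordered by $i$, where $(i,0,0)$ is negative if and only if $i<0$.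 Let $S(U_0)=\mathbb Z$, where for $k\ge0$ the state $k$ consists of the positive boxes $(0,0,0),\dots,(k-1,0,0)$, and for $k<0$ the state $k$ consists of the negative boxes $(-1,0,0),\dots,(k,0,0)$. Then these data are admissible, and the formulas $(*)$ define a unique $\mathcal E$-module structure on $U_0=V(S(U_0),\Psi(U_0))$. The $\mathcal E$-module $U_0$ is irreducible, tame, and of level $1$. -/

import Mathlib

noncomputable section

namespace QTor

/-- Fixed logarithms of the two quantum parameters. -/
structure Params where
  logq : ℂ
  logd : ℂ

namespace Params

variable (P : Params)

def q : ℂ := Complex.exp P.logq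

def d : ℂ := Complex.exp P.logd

def q₁ : ℂ := P.q⁻¹ * P.d

def q₂ : ℂ := P.q ^ 2

def q₃ : ℂ := P.q⁻¹ * P.d⁻¹

/-- For rational `a`, `b`, one has `q ^ a * d ^ b = 1` only for `a = b = 0`. -/
def Generic : Prop :=
  ∀ a b : ℚ, Complex.exp ((a : ℂ) * P.logq + (b : ℂ) * P.logd) = 1 ↔ a = 0 ∧ b = 0

/-- `q₁ ^ (-x) * q₂ ^ (-y) * q₃ ^ (-z)` for complex exponents, through the fixed logarithms. -/
def position (x y z : ℂ) : ℂ :=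
  Complex.exp (-x * (P.logd - P.logq) - y * (2 * P.logq) - z * (-P.logq - P.logd))

end Params

/-! ### Formal series

A series in one variable `X(z) = ∑ X_k z ^ (-k)` is given by the function `k ↦ X_k`; a series in
two variables `∑ f_{k,l} z ^ (-k) w ^ (-l)` by the function `k l ↦ f_{k,l}`. -/

section Series

variable (P : Params) {A : Type*} [Ring A] [Algebra ℂ A]

/-- The product `g_{i,j}(z,w) f(z,w)`, where `g_{i,j}(z,w)` is `z - q₂ w` if `i = j` and
`(z - q₁ w)(z - q₃ w)` if `i ≠ j`. -/
def gMul (i j : ZMod 2) (f : ℤ → ℤ → A) (k l : ℤ) : A :=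
  if i = j then f (k + 1) l - P.q₂ • f k (l + 1)
  else f (k + 2) l - (P.q₁ + P.q₃) • f (k + 1) (l + 1) + (P.q₁ * P.q₃) • f k (l + 2)

/-- The product `g_{i,j}(w,z) f(z,w)`. -/
def gMulSwap (i j : ZMod 2) (f : ℤ → ℤ → A) (k l : ℤ) : A :=
  gMul P i j (fun a b => f b a) l k

/-- `(-1) ^ (i + j)` for colors `i`, `j`. -/
def colorSign (i j : ZMod 2) : ℂ := if i = j then 1 else -1

/-- The `q`-commutator `[a, b]_p = a b - p b a`. -/
def qComm (p : ℂ) (a b : A) : A := a * b - p • (b * a)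

/-- The coefficient of `u ^ m` in `exp (∑_{r ≥ 0} h r * u ^ (r + 1))`. -/
def expCoeff (h : ℕ → A) (m : ℕ) : A :=
  ∑ n ∈ Finset.range (m + 1),
    ((n.factorial : ℂ)⁻¹) • PowerSeries.coeff m ((PowerSeries.X * PowerSeries.mk h) ^ n)

end Series

/-! ### The quantum toroidal algebra of type `gl₂` -/

inductive Gen : Type
  | E (i : ZMod 2) (k : ℤ)
  | F (i : ZMod 2) (k : ℤ)
  | H (i : ZMod 2) (r : {r : ℤ // r ≠ 0})
  | K (i : ZMod 2)
  | Kinv (i : ZMod 2)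
  | t
  | tinv

abbrev Free : Type := FreeAlgebra ℂ Gen

namespace Free

def E (i : ZMod 2) (k : ℤ) : Free := FreeAlgebra.ι ℂ (Gen.E i k)

def F (i : ZMod 2) (k : ℤ) : Free := FreeAlgebra.ι ℂ (Gen.F i k)

def H (i : ZMod 2) (r : {r : ℤ // r ≠ 0}) : Free := FreeAlgebra.ι ℂ (Gen.H i r)

def K (i : ZMod 2) : Free := FreeAlgebra.ι ℂ (Gen.K i)

def Kinv (i : ZMod 2) : Free := FreeAlgebra.ι ℂ (Gen.Kinv i)

def t : Free := FreeAlgebra.ι ℂ Gen.t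

def tinv : Free := FreeAlgebra.ι ℂ Gen.tinv

variable (P : Params)

/-- The coefficient of `z ^ (-n)` in
`K_i⁺(z) = K_i * exp ((q - q⁻¹) * ∑_{r > 0} H_{i,r} * z ^ (-r))`. -/
def Kplus (i : ZMod 2) (n : ℤ) : Free :=
  if 0 ≤ n then
    K i * expCoeff (fun r => (P.q - P.q⁻¹) • H i ⟨(r : ℤ) + 1, by omega⟩) n.toNat
  else 0

/-- The coefficient of `z ^ (-n)` in
`K_i⁻(z) = K_i⁻¹ * exp (-(q - q⁻¹) * ∑_{r > 0} H_{i,-r} * z ^ r)`. -/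
def Kminus (i : ZMod 2) (n : ℤ) : Free :=
  if n ≤ 0 then
    Kinv i * expCoeff (fun r => (-(P.q - P.q⁻¹)) • H i ⟨-((r : ℤ) + 1), by omega⟩) (-n).toNat
  else 0

/-- The series `K_i⁺(z)` (for `true`) or `K_i⁻(z)` (for `false`). -/
def Kcur (ε : Bool) (i : ZMod 2) (n : ℤ) : Free :=
  if ε then Kplus P i n else Kminus P i n

/-- The coefficient of `z₁ ^ (-k 0) z₂ ^ (-k 1) z₃ ^ (-k 2) w ^ (-l)` in
`Sym_{z₁,z₂,z₃} [X(z₁), [X(z₂), [X(z₃), Y(w)]_{q²}]]_{q⁻²}`. -/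
def serre (X Y : ℤ → Free) (k : Fin 3 → ℤ) (l : ℤ) : Free :=
  ((Nat.factorial 3 : ℂ)⁻¹) • ∑ σ : Equiv.Perm (Fin 3),
    qComm ((P.q ^ 2)⁻¹) (X (k (σ 0)))
      (qComm 1 (X (k (σ 1))) (qComm (P.q ^ 2) (X (k (σ 2))) (Y l)))

end Free

open Free in
/-- The defining relations (both sides of each relation are identified), coefficient by
coefficient. -/
inductive Rel (P : Params) : Free → Free → Prop
  | K_mul_Kinv (i : ZMod 2) : Rel P (K i * Kinv i) 1
  | Kinv_mul_K (i : ZMod 2) : Rel P (Kinv i * K i) 1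
  | t_mul_tinv : Rel P (t * tinv) 1
  | tinv_mul_t : Rel P (tinv * t) 1
  | t_central (g : Gen) : Rel P (t * FreeAlgebra.ι ℂ g) (FreeAlgebra.ι ℂ g * t)
  | KK (ε ε' : Bool) (i j : ZMod 2) (k l : ℤ) :
      Rel P (Kcur P ε i k * Kcur P ε' j l) (Kcur P ε' j l * Kcur P ε i k)
  | KE (ε : Bool) (i j : ZMod 2) (k l : ℤ) :
      Rel P (colorSign i j • gMul P i j (fun a b => Kcur P ε i a * E j b) k l
        + gMulSwap P j i (fun a b => E j b * Kcur P ε i a) k l) 0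
  | KF (ε : Bool) (i j : ZMod 2) (k l : ℤ) :
      Rel P (colorSign i j • gMulSwap P j i (fun a b => Kcur P ε i a * F j b) k l
        + gMul P i j (fun a b => F j b * Kcur P ε i a) k l) 0
  | EF (i j : ZMod 2) (k l : ℤ) :
      Rel P (E i k * F j l - F j l * E i k)
        (if i = j then ((P.q - P.q⁻¹)⁻¹) • (Kplus P i (k + l) - Kminus P i (k + l)) else 0)
  | EE (i j : ZMod 2) (k l : ℤ) :
      Rel P (colorSign i j • gMul P i j (fun a b => E i a * E j b) k l
        + gMulSwap P j i (fun a b => E j b * E i a) k l) 0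
  | FF (i j : ZMod 2) (k l : ℤ) :
      Rel P (colorSign i j • gMulSwap P j i (fun a b => F i a * F j b) k l
        + gMul P i j (fun a b => F j b * F i a) k l) 0
  | serreE (i : ZMod 2) (k : Fin 3 → ℤ) (l : ℤ) : Rel P (serre P (E i) (E (i + 1)) k l) 0
  | serreF (i : ZMod 2) (k : Fin 3 → ℤ) (l : ℤ) : Rel P (serre P (F i) (F (i + 1)) k l) 0

/-- The quantum toroidal algebra of type `gl₂` (the realization with commutative Cartan currents),
with the split central element `t`. -/
abbrev Toroidal (P : Params) : Type := RingQuot (Rel P)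

namespace Toroidal

variable (P : Params)

def mk : Free →ₐ[ℂ] Toroidal P := RingQuot.mkAlgHom ℂ (Rel P)

def E (i : ZMod 2) (k : ℤ) : Toroidal P := mk P (Free.E i k)

def F (i : ZMod 2) (k : ℤ) : Toroidal P := mk P (Free.F i k)

def K (i : ZMod 2) : Toroidal P := mk P (Free.K i)

def t : Toroidal P := mk P Free.t

/-- The coefficient of `z ^ (-n)` in `K_i⁺(z)`. -/
def Kplus (i : ZMod 2) (n : ℤ) : Toroidal P := mk P (Free.Kplus P i n)

/-- The coefficient of `z ^ (-n)` in `K_i⁻(z)`. -/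
def Kminus (i : ZMod 2) (n : ℤ) : Toroidal P := mk P (Free.Kminus P i n)

end Toroidal

/-! ### Rational functions -/

/-- The rational function `f(1/z)`. -/
def invertVar (f : RatFunc ℂ) : RatFunc ℂ := RatFunc.eval RatFunc.C (RatFunc.X)⁻¹ f

/-- The coefficient of `z ^ n` in the expansion of `f` at `z = 0`. -/
def coeffZero (f : RatFunc ℂ) (n : ℤ) : ℂ := (f : LaurentSeries ℂ).coeff n

/-- The coefficient of `z ^ (-n)` in the expansion of `f` at `z = ∞`. -/
def coeffInfty (f : RatFunc ℂ) (n : ℤ) : ℂ := (invertVar f : LaurentSeries ℂ).coeff n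

def poles (f : RatFunc ℂ) : Set ℂ := {p | f.denom.IsRoot p}

def RegularAt (f : RatFunc ℂ) (p : ℂ) : Prop := p ∉ poles f

def HasSimplePoles (f : RatFunc ℂ) : Prop := ∀ p ∈ poles f, f.denom.rootMultiplicity p = 1

/-- The value of `f` at a point where it is regular. -/
def value (f : RatFunc ℂ) (p : ℂ) : ℂ := RatFunc.eval (RingHom.id ℂ) p f

/-- `f` is regular at `0` and at `∞`, and `f(0) f(∞) = 1`. -/
def Balanced (f : RatFunc ℂ) : Prop :=
  RegularAt f 0 ∧ RegularAt (invertVar f) 0 ∧ value f 0 * value (invertVar f) 0 = 1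

/-- The residue of `f(z) dz / z` at `z = p`. -/
def logResidue (f : RatFunc ℂ) (p : ℂ) : ℂ :=
  (RatFunc.laurent p (f / RatFunc.X) : LaurentSeries ℂ).coeff (-1)

/-- The pair of rational functions `i_a` (`0_a` for `i = 0`, `1_a` for `i = 1`): the component
number `i` is `(q z - a) / (z - a q)`, and the other one is `1`. -/
def fundWeight (P : Params) (i : ZMod 2) (a : ℂ) : ZMod 2 → RatFunc ℂ := fun j =>
  if j = i then
    (RatFunc.C P.q * RatFunc.X - RatFunc.C a) / (RatFunc.X - RatFunc.C (a * P.q))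
  else 1

/-- The pair of rational functions `A_{i,a}(z)`. -/
def affRoot (P : Params) (i : ZMod 2) (a : ℂ) : ZMod 2 → RatFunc ℂ := fun j =>
  if j = i then
    (RatFunc.C P.q₂ * RatFunc.X - RatFunc.C a) / (RatFunc.X - RatFunc.C (P.q₂ * a))
  else
    ((RatFunc.C P.q₁ * RatFunc.X - RatFunc.C a) * (RatFunc.C P.q₃ * RatFunc.X - RatFunc.C a)) /
      ((RatFunc.X - RatFunc.C (P.q₁ * a)) * (RatFunc.X - RatFunc.C (P.q₃ * a)))

/-! ### Notions for modules

A module over the toroidal algebra on a complex vector space `V` is given by its structure map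
`ρ` to the endomorphisms of `V`. -/

section Modules

variable {P : Params} {V : Type} [AddCommGroup V] [Module ℂ V]
  (ρ : Toroidal P →ₐ[ℂ] Module.End ℂ V)

def IsIrreducible : Prop :=
  @IsSimpleModule (Toroidal P) _ V _ (Module.compHom V ρ.toRingHom)

/-- `v` is a vector of `ℓ`-weight `ψ`: `K_i^±(z) v = ψ^i(z) v`, where `ψ^i(z)` is expanded at
`∞` for the sign `+` and at `0` for the sign `-`. -/
def HasLWeight (v : V) (ψ : ZMod 2 → RatFunc ℂ) : Prop :=
  ∀ (i : ZMod 2) (n : ℤ),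
    ρ (Toroidal.Kplus P i n) v = coeffInfty (ψ i) n • v ∧
    ρ (Toroidal.Kminus P i n) v = coeffZero (ψ i) (-n) • v

/-- There is a basis of `ℓ`-weight vectors with distinct `ℓ`-weights. -/
def IsTame : Prop :=
  ∃ (J : Type) (b : Module.Basis J ℂ V) (ψ : J → ZMod 2 → RatFunc ℂ),
    Function.Injective ψ ∧ ∀ j, HasLWeight ρ (b j) (ψ j)

/-- The central element `K₀ K₁` acts as the scalar `κ`. -/
def HasLevel (κ : ℂ) : Prop :=
  ρ (Toroidal.K P 0 * Toroidal.K P 1) = κ • (1 : Module.End ℂ V)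

end Modules

/-! ### Combinatorial modules -/

/-- The data of a combinatorial module: a totally ordered set of boxes, indexed by `ι`, with colors
and coordinates; the set of negative boxes (all others are positive); the set of states; the pair
`Ψ`. A state is a finite set of boxes; its positive boxes form `λ⁺`, its negative ones `λ⁻`.
The reference state is the empty set. -/
structure Datum (ι : Type) [LinearOrder ι] where
  color : ι → ZMod 2
  x : ι → ℂ
  y : ι → ℂ
  z : ι → ℂ
  negative : Set ι
  states : Set (Finset ι)
  Ψ : ZMod 2 → RatFunc ℂ

namespace Datum

variable {ι : Type} [LinearOrder ι] (P : Params) (D : Datum ι)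

def pos (b : ι) : ℂ := P.position (D.x b) (D.y b) (D.z b)

open Classical in
/-- The state `s ⊔ b`: a positive box is added, a negative box is taken out of `s⁻`. -/
def addBox (s : Finset ι) (b : ι) : Finset ι :=
  if b ∈ D.negative then s.erase b else insert b s

open Classical in
/-- The state `s \ b`: a positive box is taken out, a negative box is put into `s⁻`. -/
def removeBox (s : Finset ι) (b : ι) : Finset ι :=
  if b ∈ D.negative then insert b s else s.erase b

/-- The convex boxes of color `i`. -/
def CV (i : ZMod 2) (s : Finset ι) : Set ι :=
  {b | D.color b = i ∧ (b ∈ D.negative ↔ b ∉ s) ∧ D.removeBox s b ∈ D.states}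

/-- The concave boxes of color `i`. -/
def CC (i : ZMod 2) (s : Finset ι) : Set ι :=
  {b | D.color b = i ∧ (b ∈ D.negative ↔ b ∈ s) ∧ D.addBox s b ∈ D.states}

open Classical in
/-- The factor which a box `b` of a state contributes to the `ℓ`-weight: `A⁻¹` if `b` is positive
and `A` if `b` is negative, with `A = A_{c(b),p(b)}`. -/
def boxWeight (b : ι) (i : ZMod 2) : RatFunc ℂ :=
  if b ∈ D.negative then affRoot P (D.color b) (D.pos P b) i
  else (affRoot P (D.color b) (D.pos P b) i)⁻¹

/-- The `ℓ`-weight of a state. -/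
def weight (s : Finset ι) (i : ZMod 2) : RatFunc ℂ := D.Ψ i * ∏ b ∈ s, D.boxWeight P b i

open Classical in
/-- The part of the `ℓ`-weight of `s` before the box `b`. It includes the weight `Ψ` of the
reference state if and only if `b` is positive. -/
def weightLT (s : Finset ι) (b : ι) (i : ZMod 2) : RatFunc ℂ :=
  (if b ∈ D.negative then 1 else D.Ψ i) * ∏ c ∈ s.filter (fun c => c < b), D.boxWeight P c i

open Classical in
/-- The part of the `ℓ`-weight of `s` after the box `b`. It includes the weight `Ψ` of the
reference state if and only if `b` is negative. -/
def weightGT (s : Finset ι) (b : ι) (i : ZMod 2) : RatFunc ℂ :=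
  (if b ∈ D.negative then D.Ψ i else 1) * ∏ c ∈ s.filter (fun c => b < c), D.boxWeight P c i

open Classical in
/-- The matrix coefficients of `F_i(z)`. -/
def coeffF (i : ZMod 2) (s : Finset ι) (b : ι) : ℂ :=
  if b ∈ D.negative then -(P.q - P.q⁻¹)⁻¹ * logResidue (D.weightGT P s b i) (D.pos P b)
  else value (D.weightGT P s b i) (D.pos P b)

open Classical in
/-- The matrix coefficients of `E_i(z)`. -/
def coeffE (i : ZMod 2) (s : Finset ι) (b : ι) : ℂ :=
  if b ∈ D.negative then value (D.weightLT P s b i) (D.pos P b)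
  else (P.q - P.q⁻¹)⁻¹ * logResidue (D.weightLT P s b i) (D.pos P b)

/-- The conventions on boxes: a box is its color and its coordinates; boxes at the same position
have the same color; boxes whose coordinates differ by integers are ordered lexicographically
according to `y > z > x`; colors alternate in the `x`- and `z`-directions. -/
structure IsBoxSystem : Prop where
  box_injective : Function.Injective fun b => (D.color b, D.x b, D.y b, D.z b)
  color_eq_of_pos_eq : ∀ b c, D.pos P b = D.pos P c → D.color b = D.color c
  lex : ∀ b c, ∀ l m n : ℤ, D.x b - D.x c = l → D.y b - D.y c = m → D.z b - D.z c = n →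
    (c < b ↔ 0 < m ∨ (m = 0 ∧ 0 < n) ∨ (m = 0 ∧ n = 0 ∧ 0 < l))
  color_sub : ∀ b c, ∀ l n : ℤ, D.x b - D.x c = l → D.z b - D.z c = n →
    D.color b - D.color c = ((l + n : ℤ) : ZMod 2)

/-- Every state is connected to the reference state by a sequence of removals of boxes (from `λ⁺`
or from `λ⁻`) which stays in the set of states. -/
def Connected : Prop :=
  ∀ s ∈ D.states, Relation.ReflTransGen
    (fun s s' : Finset ι => s' ∈ D.states ∧ ∃ b ∈ s, s' = s.erase b) s ∅

/-- The assumptions under which the data define a combinatorial module. -/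
structure IsAdmissible : Prop where
  boxes : D.IsBoxSystem P
  empty_mem : ∅ ∈ D.states
  connected : D.Connected
  A1 : Set.InjOn (D.weight P) D.states
  A2 : ∀ s ∈ D.states, ∀ i, Balanced (D.weight P s i) ∧ HasSimplePoles (D.weight P s i)
  A3 : ∀ s ∈ D.states, ∀ i, Set.BijOn (D.pos P) (D.CC i s ∪ D.CV i s) (poles (D.weight P s i))
  A4 : ∀ s ∈ D.states, ∀ i, ∀ b ∈ D.CC i s ∪ D.CV i s,
    (b ∉ D.negative → RegularAt (D.weightGT P s b i) (D.pos P b)) ∧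
    (b ∈ D.negative → RegularAt (D.weightLT P s b i) (D.pos P b))
  A5_concave : ∀ s ∈ D.states, ∀ i j, ∀ b ∈ D.CC i s, ∀ c ∈ D.CC j (D.addBox s b),
    c ∉ D.CC j s →
    (D.x c, D.y c, D.z c) ∈ ({(D.x b, D.y b, D.z b + 1), (D.x b, D.y b + 1, D.z b),
      (D.x b + 1, D.y b, D.z b)} : Set (ℂ × ℂ × ℂ))
  A5_convex : ∀ s ∈ D.states, ∀ i j, ∀ b ∈ D.CC i s, ∀ c ∈ D.CV j s,
    c ∉ D.CV j (D.addBox s b) →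
    (D.x c, D.y c, D.z c) ∈ ({(D.x b, D.y b, D.z b), (D.x b, D.y b, D.z b - 1),
      (D.x b, D.y b - 1, D.z b), (D.x b - 1, D.y b, D.z b)} : Set (ℂ × ℂ × ℂ))

/-- The vector space with a basis labeled by the states. -/
abbrev Space : Type := D.states →₀ ℂ

open Classical in
/-- The basis vector of a state. -/
def ket (s : Finset ι) : D.Space := if h : s ∈ D.states then Finsupp.single ⟨s, h⟩ 1 else 0

/-- `ρ` is given on the generating series by the combinatorial formulas; the coefficient of
`z ^ (-n)` in `δ(z / p)` is `p ^ n`. -/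
structure IsAction (ρ : Toroidal P →ₐ[ℂ] Module.End ℂ D.Space) : Prop where
  Kplus : ∀ s ∈ D.states, ∀ (i : ZMod 2) (n : ℤ),
    ρ (Toroidal.Kplus P i n) (D.ket s) = coeffInfty (D.weight P s i) n • D.ket s
  Kminus : ∀ s ∈ D.states, ∀ (i : ZMod 2) (n : ℤ),
    ρ (Toroidal.Kminus P i n) (D.ket s) = coeffZero (D.weight P s i) (-n) • D.ket s
  F : ∀ s ∈ D.states, ∀ (i : ZMod 2) (n : ℤ),
    ρ (Toroidal.F P i n) (D.ket s) =
      ∑ᶠ (b : ι) (_ : b ∈ D.CC i s), (D.coeffF P i s b * D.pos P b ^ n) • D.ket (D.addBox s b)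
  E : ∀ s ∈ D.states, ∀ (i : ZMod 2) (n : ℤ),
    ρ (Toroidal.E P i n) (D.ket s) =
      ∑ᶠ (b : ι) (_ : b ∈ D.CV i s), (D.coeffE P i s b * D.pos P b ^ n) • D.ket (D.removeBox s b)
  t : ρ (Toroidal.t P) = 1

end Datum

/-! ### The vector module -/

/-- The state `k`: the boxes `0, …, k - 1` if `k ≥ 0`, the boxes `-1, …, k` if `k < 0`. -/
def vectorState (k : ℤ) : Finset ℤ := if 0 ≤ k then Finset.Ico 0 k else Finset.Ico k 0

theorem vectorState_injective : Function.Injective vectorState := by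
  intro k l h
  have e : ∀ n : ℤ, n ∈ vectorState k ↔ n ∈ vectorState l := fun n => by rw [h]
  have h1 := e k
  have h2 := e l
  unfold vectorState at h1 h2
  split_ifs at h1 h2 <;> simp only [Finset.mem_Ico] at h1 h2 <;> omega

/-- The data of the vector module of color `0`: the boxes `(i, 0, 0)` of color `i` mod `2` for
`i ∈ ℤ`, the negative ones being those with `i < 0`; the states `k ∈ ℤ`; and
`Ψ = 0_{q⁻¹} 1_{q q₁}⁻¹`. -/
def vectorDatum (P : Params) : Datum ℤ where
  color i := (i : ZMod 2)
  x i := (i : ℂ)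
  y _ := 0
  z _ := 0
  negative := {i | i < 0}
  states := Set.range vectorState
  Ψ := fundWeight P 0 P.q⁻¹ * (fundWeight P 1 (P.q * P.q₁))⁻¹

end QTor

end

noncomputable section

namespace QTor

open scoped LaurentSeries

/-! ### Expansions of rational functions -/

/-! Write p_k = q₁^(-k) for the position of box k, and φ_k for the weight of the state k. The
weights telescope: passing from k+1 to k multiplies by the affine root A at p_k, and since q₁q₂q₃ =
1 almost everything cancels. Each component of φ_k therefore has degree one: (qz - q⁻¹p_k)/(z - p_k)
in the color of k, and (q⁻¹z - q p_{k-1})/(z - p_{k-1}) in the other color (`stateWeight_succ_mul`,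
`weight_vectorState`). The single pole of a component is the position of the only box of that color
that can be added (k) or removed (k-1). Admissibility is read off from this, using that genericity
makes the p_k distinct.

The residues of φ dz/z at these poles are ±(q - q⁻¹), so every matrix coefficient equals 1. The
color-k currents step between the states k and k+1 with coefficient δ(z/p_k), and there are no other
matrix elements of E and F. The relations are then checked on basis vectors. Those between K and E
or F become one identity of rational functions, `gFun_mul_stateWeight`. The one between E and F
holds because the two expansions of a simple pole differ by a delta function
(`coeffCur_mobius_sub`). In the quadratic ones each term vanishes: two successive steps have
different colors and sit at z = q₁w, a zero of the structure function. The Serre relations hold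
because two steps of the same color compose to 0. The H generators act by logarithms of the
normalized K currents.

For uniqueness, an exponential determines its exponent (`expCoeff_injective`), so the K currents fix
the H generators. For irreducibility, E_{0,0}F_{0,1} + E_{1,0}F_{1,1} is diagonal with the distinct
eigenvalues p_k; a nonzero submodule thus contains a basis vector, and E and F move it to all the
others. The tame basis and the level come from the explicit φ_k. -/

theorem transcendental_inv_X : Transcendental ℂ ((RatFunc.X : RatFunc ℂ)⁻¹) := fun h =>
  RatFunc.transcendental_X (K := ℂ) (by simpa using h.inv)

/-- The substitution `z ↦ 1/z` as an algebra homomorphism. -/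
def invertVarHom : RatFunc ℂ →ₐ[ℂ] RatFunc ℂ :=
  (IntermediateField.val _).comp
    (RatFunc.algEquivOfTranscendental (RatFunc.X : RatFunc ℂ)⁻¹ transcendental_inv_X).toAlgHom

/-- Evaluation of a rational function need not respect sums and products at a pole. Since 1/z is
transcendental, the substitution is a genuine homomorphism, and the expansion at ∞ becomes linear in
f. -/
theorem invertVar_eq (f : RatFunc ℂ) : invertVar f = invertVarHom f := by
  have : invertVarHom f = Polynomial.aeval (RatFunc.X : RatFunc ℂ)⁻¹ f.num /
      Polynomial.aeval (RatFunc.X : RatFunc ℂ)⁻¹ f.denom :=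
    RatFunc.algEquivOfTranscendental_apply _ transcendental_inv_X f
  rw [this]
  rfl

theorem invertVarHom_X : invertVarHom RatFunc.X = (RatFunc.X)⁻¹ :=
  RatFunc.algEquivOfTranscendental_X _ transcendental_inv_X

theorem invertVarHom_C (a : ℂ) : invertVarHom (RatFunc.C a) = RatFunc.C a :=
  invertVarHom.commutes a

theorem coe_C_laurent (a : ℂ) :
    ((RatFunc.C a : RatFunc ℂ) : ℂ⸨X⸩) = HahnSeries.C a := by
  rw [← RatFunc.algebraMap_C, ← IsScalarTower.algebraMap_apply]
  simp [Polynomial.algebraMap_hahnSeries_apply]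

/-- The coefficient of `z ^ (-n)` in the expansion at `∞` (for `true`) or `0` (for `false`). -/
def coeffCur (ε : Bool) (f : RatFunc ℂ) (n : ℤ) : ℂ :=
  if ε then coeffInfty f n else coeffZero f (-n)

theorem coeffCur_zero (ε : Bool) (n : ℤ) : coeffCur ε 0 n = 0 := by
  cases ε <;> simp [coeffCur, coeffInfty, coeffZero, invertVar_eq]

theorem coeffCur_add (ε : Bool) (f g : RatFunc ℂ) (n : ℤ) :
    coeffCur ε (f + g) n = coeffCur ε f n + coeffCur ε g n := by
  cases ε <;> simp [coeffCur, coeffInfty, coeffZero, invertVar_eq]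

theorem coeffCur_C_mul (ε : Bool) (a : ℂ) (f : RatFunc ℂ) (n : ℤ) :
    coeffCur ε (RatFunc.C a * f) n = a * coeffCur ε f n := by
  cases ε <;> simp [coeffCur, coeffInfty, coeffZero, invertVar_eq, invertVarHom_C, coe_C_laurent]

theorem coeffCur_X_mul (ε : Bool) (f : RatFunc ℂ) (n : ℤ) :
    coeffCur ε (RatFunc.X * f) n = coeffCur ε f (n + 1) := by
  cases ε
  · simp only [coeffCur, coeffZero, map_mul, RatFunc.coe_X, HahnSeries.coeff_single_mul]
    simp [sub_eq_add_neg, add_comm]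
  · simp only [coeffCur, coeffInfty, invertVar_eq, map_mul, invertVarHom_X, map_inv₀,
      RatFunc.coe_X, HahnSeries.inv_single, HahnSeries.coeff_single_mul]
    simp

theorem coeffCur_one (ε : Bool) (n : ℤ) : coeffCur ε 1 n = if n = 0 then 1 else 0 := by
  cases ε <;> simp [coeffCur, coeffInfty, coeffZero, invertVar_eq, HahnSeries.coeff_one]

theorem X_sub_C_ne_zero (p : ℂ) : (RatFunc.X - RatFunc.C p : RatFunc ℂ) ≠ 0 := by
  have := (map_ne_zero_iff (algebraMap (Polynomial ℂ) (RatFunc ℂ))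
    (RatFunc.algebraMap_injective ℂ)).2 (Polynomial.X_sub_C_ne_zero p)
  simpa using this

theorem coe_inv_X_sub_C {p : ℂ} (hp : p ≠ 0) :
    (((RatFunc.X - RatFunc.C p)⁻¹ : RatFunc ℂ) : ℂ⸨X⸩) =
      HahnSeries.ofPowerSeries ℤ ℂ (PowerSeries.mk fun m => -(p⁻¹) ^ (m + 1)) := by
  have h : (PowerSeries.X - PowerSeries.C p) *
      PowerSeries.mk (fun m => -(p⁻¹) ^ (m + 1)) = 1 := by
    ext m
    rw [sub_mul, map_sub]
    cases m with
    | zero => simp [hp]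
    | succ m =>
      rw [PowerSeries.coeff_succ_X_mul, PowerSeries.coeff_C_mul, PowerSeries.coeff_mk,
        PowerSeries.coeff_mk, PowerSeries.coeff_one, if_neg (by omega), pow_succ _ (m + 1)]
      field_simp
      ring
  have h2 := congrArg (HahnSeries.ofPowerSeries ℤ ℂ) h
  rw [map_mul, map_sub, PowerSeries.coe_X, PowerSeries.coe_C, PowerSeries.coe_one] at h2
  rw [map_inv₀, map_sub, RatFunc.coe_X, coe_C_laurent]
  exact (eq_inv_of_mul_eq_one_right h2).symm

theorem coe_inv_one_sub_C_mul_X (p : ℂ) :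
    (((1 - RatFunc.C p * RatFunc.X)⁻¹ : RatFunc ℂ) : ℂ⸨X⸩) =
      HahnSeries.ofPowerSeries ℤ ℂ (PowerSeries.mk fun m => p ^ m) := by
  have h : (1 - PowerSeries.C p * PowerSeries.X) *
      PowerSeries.mk (fun m => p ^ m) = 1 := by
    ext m
    rw [sub_mul, map_sub, mul_assoc]
    cases m with
    | zero => simp
    | succ m =>
      rw [PowerSeries.coeff_C_mul, PowerSeries.coeff_succ_X_mul]
      simp [PowerSeries.coeff_one, pow_succ']
  have h2 := congrArg (HahnSeries.ofPowerSeries ℤ ℂ) h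
  rw [map_mul, map_sub, map_mul, PowerSeries.coe_X, PowerSeries.coe_C, PowerSeries.coe_one] at h2
  rw [map_inv₀, map_sub, map_mul, RatFunc.coe_X, coe_C_laurent, map_one]
  exact (eq_inv_of_mul_eq_one_right h2).symm

theorem coeffCur_false_inv_X_sub_C {p : ℂ} (hp : p ≠ 0) (n : ℤ) :
    coeffCur false (RatFunc.X - RatFunc.C p)⁻¹ n = if 0 < n then 0 else -p ^ (n - 1) := by
  simp only [coeffCur, coeffZero, coe_inv_X_sub_C hp, PowerSeries.coeff_coe]
  by_cases h : 0 < n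
  · simp [h]
  · obtain ⟨m, rfl⟩ : ∃ m : ℕ, n = -m := ⟨n.natAbs, by omega⟩
    simp only [h, if_false, PowerSeries.coeff_mk, Bool.false_eq_true, neg_neg]
    rw [if_neg (by omega), show (-(m : ℤ) - 1) = -((m + 1 : ℕ) : ℤ) by push_cast; ring, zpow_neg,
      zpow_natCast, inv_pow, Int.natAbs_natCast]

theorem coeffCur_true_inv_X_sub_C {p : ℂ} (n : ℤ) :
    coeffCur true (RatFunc.X - RatFunc.C p)⁻¹ n = if 0 < n then p ^ (n - 1) else 0 := by
  have h : invertVarHom (RatFunc.X - RatFunc.C p)⁻¹ =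
      RatFunc.X * (1 - RatFunc.C p * RatFunc.X)⁻¹ := by
    rw [map_inv₀, map_sub, invertVarHom_X, invertVarHom_C, ← inv_inv (RatFunc.X * _), mul_inv,
      inv_inv, mul_sub, mul_one]
    congr 1
    rw [mul_left_comm, inv_mul_cancel₀ RatFunc.X_ne_zero, mul_one]
  simp only [coeffCur, coeffInfty, invertVar_eq, h, map_mul, RatFunc.coe_X,
    coe_inv_one_sub_C_mul_X, HahnSeries.coeff_single_mul, PowerSeries.coeff_coe, one_mul, if_true]
  by_cases h : 0 < n
  · obtain ⟨m, rfl⟩ : ∃ m : ℕ, n = m + 1 := ⟨(n - 1).toNat, by omega⟩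
    simp [h]
  · rw [if_neg h, if_pos (by omega)]

/-! ### Rational functions of degree one -/

/-- The rational function `(α z - β p) / (z - p)`. -/
def mobius (α β p : ℂ) : RatFunc ℂ :=
  (RatFunc.C α * RatFunc.X - RatFunc.C (β * p)) / (RatFunc.X - RatFunc.C p)

/-- Partial fractions. In this normalization α is the value at ∞, β is the value at 0 if p ≠ 0, and
only α - β enters the polar part. -/
theorem mobius_eq (α β p : ℂ) :
    mobius α β p = RatFunc.C α * 1 +
      RatFunc.C ((α - β) * p) * (RatFunc.X - RatFunc.C p)⁻¹ := by
  have := X_sub_C_ne_zero p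
  rw [mobius]
  field_simp
  simp only [map_mul, map_sub]
  ring

theorem coeffCur_true_mobius {p : ℂ} (hp : p ≠ 0) (α β : ℂ) (n : ℤ) :
    coeffCur true (mobius α β p) n =
      if n < 0 then 0 else if n = 0 then α else (α - β) * p ^ n := by
  rw [mobius_eq, coeffCur_add, coeffCur_C_mul, coeffCur_C_mul, coeffCur_one,
    coeffCur_true_inv_X_sub_C]
  rcases lt_trichotomy n 0 with h | h | h
  · simp [h, h.ne, h.not_gt]
  · simp [h]
  · simp only [h.ne', h, h.not_gt, if_true, if_false]
    rw [zpow_sub_one₀ hp]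
    field_simp
    ring

theorem coeffCur_false_mobius {p : ℂ} (hp : p ≠ 0) (α β : ℂ) (n : ℤ) :
    coeffCur false (mobius α β p) n =
      if 0 < n then 0 else if n = 0 then β else -((α - β) * p ^ n) := by
  rw [mobius_eq, coeffCur_add, coeffCur_C_mul, coeffCur_C_mul, coeffCur_one,
    coeffCur_false_inv_X_sub_C hp]
  rcases lt_trichotomy n 0 with h | h | h
  · simp only [h.ne, h.not_gt, if_false]
    rw [zpow_sub_one₀ hp]
    field_simp
    ring
  · subst h
    simp [hp]
  · simp [h, h.ne']

/-- The expansions at ∞ and at 0 of a simple pole differ by a multiple of δ(z/p). This is the source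
of the delta function in the commutator of E and F. -/
theorem coeffCur_mobius_sub {p : ℂ} (hp : p ≠ 0) (α β : ℂ) (n : ℤ) :
    coeffCur true (mobius α β p) n - coeffCur false (mobius α β p) n = (α - β) * p ^ n := by
  rw [coeffCur_true_mobius hp, coeffCur_false_mobius hp]
  rcases lt_trichotomy n 0 with h | h | h
  · simp [h, h.ne, h.not_gt]
  · simp [h]
  · simp [h, h.ne', h.not_gt]

theorem denom_linear_div_dvd (a b p : ℂ) :
    ((RatFunc.C a * RatFunc.X - RatFunc.C b) / (RatFunc.X - RatFunc.C p)).denom ∣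
      Polynomial.X - Polynomial.C p := by
  have := RatFunc.denom_div_dvd (K := ℂ) (Polynomial.C a * Polynomial.X - Polynomial.C b)
    (Polynomial.X - Polynomial.C p)
  simpa using this

/-- The denominator divides the irreducible z - p. If it were 1, the function would be a polynomial,
and clearing denominators and evaluating at p would give a p = b. -/
theorem denom_linear_div {a b p : ℂ} (h : a * p ≠ b) :
    ((RatFunc.C a * RatFunc.X - RatFunc.C b) / (RatFunc.X - RatFunc.C p)).denom =
      Polynomial.X - Polynomial.C p := by
  set f := (RatFunc.C a * RatFunc.X - RatFunc.C b) / (RatFunc.X - RatFunc.C p) with hf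
  have hd := denom_linear_div_dvd a b p
  rcases (Polynomial.irreducible_X_sub_C p).dvd_iff.1 hd with hu | ha
  · exfalso
    have h1 : f.denom = 1 := (RatFunc.monic_denom f).eq_one_of_isUnit hu
    have h2 : f = algebraMap _ _ f.num := by
      conv_lhs => rw [← RatFunc.num_div_denom f, h1, map_one, div_one]
    have h3 : algebraMap (Polynomial ℂ) (RatFunc ℂ)
        (Polynomial.C a * Polynomial.X - Polynomial.C b) =
        algebraMap _ _ (f.num * (Polynomial.X - Polynomial.C p)) := by
      rw [map_mul, ← h2, hf]
      simp [div_mul_cancel₀ _ (X_sub_C_ne_zero p)]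
    have h4 := congrArg (Polynomial.eval p) (RatFunc.algebraMap_injective ℂ h3)
    simp [sub_eq_zero] at h4
    exact h h4
  · exact (Polynomial.eq_of_monic_of_associated (Polynomial.monic_X_sub_C p)
      (RatFunc.monic_denom f) ha).symm

theorem denom_mobius {α β p : ℂ} (h : α ≠ β) (hp : p ≠ 0) :
    (mobius α β p).denom = Polynomial.X - Polynomial.C p :=
  denom_linear_div fun e => h (mul_right_cancel₀ hp e)

theorem poles_mobius {α β p : ℂ} (h : α ≠ β) (hp : p ≠ 0) : poles (mobius α β p) = {p} := by
  ext z
  simp [poles, denom_mobius h hp, Polynomial.IsRoot, sub_eq_zero]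

theorem hasSimplePoles_mobius {α β p : ℂ} (h : α ≠ β) (hp : p ≠ 0) :
    HasSimplePoles (mobius α β p) := by
  intro z hz
  rw [poles_mobius h hp] at hz
  rw [Set.mem_singleton_iff.1 hz, denom_mobius h hp, Polynomial.rootMultiplicity_X_sub_C_self]

theorem regularAt_one (p : ℂ) : RegularAt 1 p := by
  simp [RegularAt, poles, Polynomial.IsRoot]

theorem value_one (p : ℂ) : value 1 p = 1 := by simp [value]

/-- Evaluation is multiplicative at regular points, so a value can be computed from a cleared
equation without knowing the reduced numerator and denominator. -/
theorem value_mul_linear {f : RatFunc ℂ} {a b c d z : ℂ} (hf : RegularAt f z)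
    (h : f * (RatFunc.C a * RatFunc.X - RatFunc.C b) = RatFunc.C c * RatFunc.X - RatFunc.C d) :
    value f z * (a * z - b) = c * z - d := by
  have e : ∀ s t : ℂ, (RatFunc.C s * RatFunc.X - RatFunc.C t : RatFunc ℂ) =
      algebraMap (Polynomial ℂ) _ (Polynomial.C s * Polynomial.X - Polynomial.C t) := by
    intro s t; simp
  have h2 := congrArg (RatFunc.eval (RingHom.id ℂ) z) h
  rw [RatFunc.eval_mul _ _ hf, e, e, RatFunc.eval_algebraMap, RatFunc.eval_algebraMap] at h2
  · simpa [value] using h2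
  · rw [e, RatFunc.denom_algebraMap]
    simp

theorem balanced_mobius {α β p : ℂ} (h : α ≠ β) (hp : p ≠ 0) (hαβ : α * β = 1) :
    Balanced (mobius α β p) := by
  have hX := X_sub_C_ne_zero p
  have hX' := X_sub_C_ne_zero p⁻¹
  have h0 : RegularAt (mobius α β p) 0 := by
    rw [RegularAt, poles_mobius h hp]
    simpa using hp.symm
  -- Inverting the variable exchanges the values α and β at ∞ and 0 and moves the pole to p⁻¹.
  have hi : invertVar (mobius α β p) =
      (RatFunc.C β * RatFunc.X - RatFunc.C (α * p⁻¹)) / (RatFunc.X - RatFunc.C p⁻¹) := by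
    have hc : RatFunc.C p * RatFunc.C p⁻¹ = 1 := by
      rw [← map_mul, mul_inv_cancel₀ hp, map_one]
    have hd := (map_ne_zero_iff invertVarHom invertVarHom.injective).2 hX
    rw [invertVar_eq, mobius, map_div₀, div_eq_div_iff hd hX']
    simp only [map_sub, map_mul, invertVarHom_X, invertVarHom_C]
    linear_combination (RatFunc.C α - RatFunc.C β) *
      (inv_mul_cancel₀ (RatFunc.X_ne_zero (K := ℂ)) - hc)
  have hr : RegularAt (invertVar (mobius α β p)) 0 := by
    intro hz
    rw [hi] at hz
    have := Polynomial.IsRoot.dvd hz (denom_linear_div_dvd _ _ _)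
    simp [hp] at this
  refine ⟨h0, hr, ?_⟩
  have e1 := value_mul_linear (a := 1) (b := p) (c := α) (d := β * p) h0 (by
    rw [mobius, map_one, one_mul, div_mul_cancel₀ _ hX])
  have e2 := value_mul_linear (a := 1) (b := p⁻¹) (c := β) (d := α * p⁻¹) hr (by
    rw [hi, map_one, one_mul, div_mul_cancel₀ _ hX'])
  have e1' : value (mobius α β p) 0 = β := mul_right_cancel₀ hp (by linear_combination -e1)
  have e2' : value (invertVar (mobius α β p)) 0 = α :=
    mul_right_cancel₀ (inv_ne_zero hp) (by linear_combination -e2)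
  rw [e1', e2', mul_comm, hαβ]

theorem logResidue_mobius {p : ℂ} (hp : p ≠ 0) (α β : ℂ) :
    logResidue (mobius α β p) p = α - β := by
  have hX := X_sub_C_ne_zero (-p)
  rw [map_neg, sub_neg_eq_add] at hX
  have hX0 := RatFunc.X_ne_zero (K := ℂ)
  -- Partial fractions of f(z)/z after translating p to the origin. The pole of f(z)/z at 0 moves to
  -- -p ≠ 0 and does not contribute to the residue.
  have h : RatFunc.laurent p (mobius α β p / RatFunc.X) =
      RatFunc.C (α - β) * (RatFunc.X)⁻¹ + RatFunc.C β * (RatFunc.X - RatFunc.C (-p))⁻¹ := by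
    simp only [mobius, map_div₀, map_sub, map_mul, RatFunc.laurent_X, RatFunc.laurent_C, map_neg,
      add_sub_cancel_right, sub_neg_eq_add]
    field_simp
    ring
  rw [logResidue, h, map_add, map_mul, map_mul, coe_inv_X_sub_C (neg_ne_zero.2 hp), map_inv₀,
    RatFunc.coe_X, HahnSeries.inv_single, coe_C_laurent, coe_C_laurent, HahnSeries.coeff_add,
    HahnSeries.C_mul_eq_smul, HahnSeries.C_mul_eq_smul, HahnSeries.coeff_smul,
    HahnSeries.coeff_smul, PowerSeries.coeff_coe]
  simp

/-! ### Parameters and positions -/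

theorem Params.q_ne_zero (P : Params) : P.q ≠ 0 := Complex.exp_ne_zero _

theorem Params.d_ne_zero (P : Params) : P.d ≠ 0 := Complex.exp_ne_zero _

theorem Params.q₁_ne_zero (P : Params) : P.q₁ ≠ 0 :=
  mul_ne_zero (inv_ne_zero P.q_ne_zero) P.d_ne_zero

theorem Params.q₃_ne_zero (P : Params) : P.q₃ ≠ 0 :=
  mul_ne_zero (inv_ne_zero P.q_ne_zero) (inv_ne_zero P.d_ne_zero)

theorem Params.q₁_mul_q₃ (P : Params) : P.q₁ * P.q₃ = P.q⁻¹ * P.q⁻¹ := by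
  have := P.q_ne_zero
  have := P.d_ne_zero
  rw [Params.q₁, Params.q₃]
  field_simp

theorem Params.q₁_eq_exp (P : Params) : P.q₁ = Complex.exp (P.logd - P.logq) := by
  rw [Params.q₁, Params.q, Params.d, ← Complex.exp_neg, ← Complex.exp_add]
  congr 1
  ring

theorem Params.Generic.q_ne_inv {P : Params} (hP : P.Generic) : P.q ≠ P.q⁻¹ := by
  intro h
  have h2 : P.q ^ 2 = 1 := by
    rw [sq]
    nth_rewrite 1 [h]
    exact inv_mul_cancel₀ P.q_ne_zero
  have := (hP 2 0).1 (by
    rw [← h2, Params.q, ← Complex.exp_nat_mul]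
    congr 1
    push_cast
    ring)
  norm_num at this

theorem Params.Generic.q_sub_inv_ne_zero {P : Params} (hP : P.Generic) : P.q - P.q⁻¹ ≠ 0 :=
  sub_ne_zero.2 hP.q_ne_inv

theorem Params.Generic.q₁_zpow_injective {P : Params} (hP : P.Generic) :
    Function.Injective fun n : ℤ => P.q₁ ^ n := by
  intro m n h
  have h1 : P.q₁ ^ (m - n) = 1 := by
    rw [zpow_sub₀ P.q₁_ne_zero]
    exact div_eq_one_iff_eq (zpow_ne_zero _ P.q₁_ne_zero) |>.2 h
  -- Genericity is applied to q₁^(m-n) = q^(-(m-n)) d^(m-n).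
  have := (hP (-(m - n : ℤ)) (m - n : ℤ)).1 (by
    rw [← h1, Params.q₁_eq_exp, ← Complex.exp_int_mul]
    congr 1
    push_cast
    ring)
  have h2 := this.2
  norm_cast at h2
  omega

/-- The position of the box `(k, 0, 0)`. -/
def boxPos (P : Params) (k : ℤ) : ℂ := P.q₁ ^ (-k)

theorem vectorDatum_pos (P : Params) (k : ℤ) : (vectorDatum P).pos P k = boxPos P k := by
  rw [boxPos, Params.q₁_eq_exp, ← Complex.exp_int_mul]
  simp [Datum.pos, vectorDatum, Params.position]

theorem boxPos_ne_zero (P : Params) (k : ℤ) : boxPos P k ≠ 0 := zpow_ne_zero _ P.q₁_ne_zero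

theorem Params.Generic.boxPos_injective {P : Params} (hP : P.Generic) :
    Function.Injective (boxPos P) := fun _ _ h => neg_injective (hP.q₁_zpow_injective h)

theorem boxPos_eq (P : Params) (k : ℤ) : boxPos P k = P.q₁ * boxPos P (k + 1) := by
  rw [boxPos, boxPos, ← zpow_one_add₀ P.q₁_ne_zero]
  congr 1
  ring

/-! ### Colors -/

theorem color_ne_add_one (i : ZMod 2) : i ≠ i + 1 := by revert i; decide

theorem color_eq_add_one_iff {i j : ZMod 2} : i = j + 1 ↔ ¬ i = j := by revert i j; decide

theorem color_eq_sub_one_iff {i j : ZMod 2} : i = j - 1 ↔ ¬ i = j := by revert i j; decide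

/-! ### Weights of the states of the vector module -/

/-- The `ℓ`-weight of the state `k` of the vector module. -/
def stateWeight (P : Params) (k : ℤ) (i : ZMod 2) : RatFunc ℂ :=
  if i = k then mobius P.q P.q⁻¹ (boxPos P k) else mobius P.q⁻¹ P.q (boxPos P (k - 1))

theorem C_mul_X_sub_C {a : ℂ} (ha : a ≠ 0) (b : ℂ) :
    (RatFunc.C a * RatFunc.X - RatFunc.C b : RatFunc ℂ) =
      RatFunc.C a * (RatFunc.X - RatFunc.C (a⁻¹ * b)) := by
  rw [mul_sub, ← map_mul, mul_inv_cancel_left₀ ha]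

theorem C_mul_X_sub_C_ne_zero {a : ℂ} (ha : a ≠ 0) (b : ℂ) :
    (RatFunc.C a * RatFunc.X - RatFunc.C b : RatFunc ℂ) ≠ 0 := by
  rw [C_mul_X_sub_C ha]
  exact mul_ne_zero ((map_ne_zero _).2 ha) (X_sub_C_ne_zero _)

theorem affRoot_ne_zero (P : Params) (i j : ZMod 2) (a : ℂ) : affRoot P i a j ≠ 0 := by
  have h2 : P.q₂ ≠ 0 := pow_ne_zero _ P.q_ne_zero
  unfold affRoot
  split_ifs
  · exact div_ne_zero (C_mul_X_sub_C_ne_zero h2 _) (X_sub_C_ne_zero _)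
  · exact div_ne_zero (mul_ne_zero (C_mul_X_sub_C_ne_zero P.q₁_ne_zero _)
      (C_mul_X_sub_C_ne_zero P.q₃_ne_zero _)) (mul_ne_zero (X_sub_C_ne_zero _) (X_sub_C_ne_zero _))

/-- In the color of k, the zero q₂p_k of the weight cancels the pole of A. In the other color, the
pole p_{k+1} = q₁⁻¹p_k and the zero q⁻²p_{k+1} = q₃p_k cancel against a zero and a pole of A,
leaving the pole q₁p_k = p_{k-1}. The leading constants match because q₁q₃ = q⁻². -/
theorem stateWeight_succ_mul (P : Params) (k : ℤ) (i : ZMod 2) :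
    stateWeight P (k + 1) i * affRoot P k (boxPos P k) i = stateWeight P k i := by
  have hq := P.q_ne_zero
  have hp := boxPos_ne_zero P (k + 1)
  have h1 := P.q₁_ne_zero
  have hd := P.d_ne_zero
  have h3 := P.q₃_ne_zero
  have h2 : P.q₂ ≠ 0 := pow_ne_zero _ hq
  have hqi := inv_ne_zero hq
  by_cases hi : i = k
  · have e1 : P.q₂⁻¹ * boxPos P k = P.q⁻¹ * (P.q⁻¹ * boxPos P k) := by
      rw [Params.q₂]; field_simp
    have e2 : P.q⁻¹⁻¹ * (P.q * boxPos P k) = P.q₂ * boxPos P k := by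
      rw [Params.q₂, inv_inv]; ring
    have hk : ¬ i = ((k + 1 : ℤ) : ZMod 2) := by
      rw [hi]; push_cast; exact color_ne_add_one _
    rw [stateWeight, stateWeight, affRoot, if_neg hk, if_pos hi, if_pos hi, mobius, mobius,
      add_sub_cancel_right, C_mul_X_sub_C hqi, C_mul_X_sub_C h2, C_mul_X_sub_C hq, e1, e2]
    have hX := X_sub_C_ne_zero (boxPos P k)
    have hX2 := X_sub_C_ne_zero (P.q₂ * boxPos P k)
    have hc : RatFunc.C P.q⁻¹ * RatFunc.C P.q₂ = RatFunc.C P.q := by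
      rw [← map_mul, Params.q₂]
      congr 1
      field_simp
    rw [← hc]
    field_simp
  · have hk : i = ((k + 1 : ℤ) : ZMod 2) := by
      push_cast; exact color_eq_add_one_iff.2 hi
    have e1 : boxPos P (k - 1) = P.q₁ * boxPos P k := by
      rw [boxPos_eq, sub_add_cancel]
    have e2 : P.q₁⁻¹ * boxPos P k = boxPos P (k + 1) := by
      rw [boxPos_eq, inv_mul_cancel_left₀ h1]
    have e3 : P.q⁻¹ * (P.q⁻¹ * boxPos P (k + 1)) = P.q₃ * boxPos P k := by
      rw [boxPos_eq P k, ← mul_assoc, ← mul_assoc, mul_comm P.q₃, P.q₁_mul_q₃]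
    have e4 : P.q⁻¹⁻¹ * (P.q * (P.q₁ * boxPos P k)) = P.q₃⁻¹ * boxPos P k := by
      rw [Params.q₁, Params.q₃]
      field_simp
    rw [stateWeight, stateWeight, affRoot, if_pos hk, if_neg hi, if_neg hi, mobius, mobius,
      e1, C_mul_X_sub_C hqi, C_mul_X_sub_C hq, C_mul_X_sub_C h1, C_mul_X_sub_C h3, e2, e3, e4]
    have hX1 := X_sub_C_ne_zero (boxPos P (k + 1))
    have hX2 := X_sub_C_ne_zero (P.q₁ * boxPos P k)
    have hX3 := X_sub_C_ne_zero (P.q₃ * boxPos P k)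
    have hc : RatFunc.C P.q * (RatFunc.C P.q₁ * RatFunc.C P.q₃) = RatFunc.C P.q⁻¹ := by
      rw [← map_mul, ← map_mul, P.q₁_mul_q₃]
      congr 1
      field_simp
    rw [← hc]
    field_simp

/-- The state k is the symmetric difference of the half-lines {b < 0} and {b < k}. This description
treats both signs at once and reduces the combinatorics of boxes to linear arithmetic. -/
theorem mem_vectorState {k b : ℤ} : b ∈ vectorState k ↔ (b < 0 ↔ ¬ b < k) := by
  unfold vectorState
  split_ifs <;> simp only [Finset.mem_Ico] <;> omega

theorem vectorState_zero : vectorState 0 = ∅ := by simp [vectorState]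

theorem mem_vectorDatum_negative (P : Params) (b : ℤ) :
    b ∈ (vectorDatum P).negative ↔ b < 0 := Iff.rfl

theorem addBox_vectorState (P : Params) (k : ℤ) :
    (vectorDatum P).addBox (vectorState k) k = vectorState (k + 1) := by
  ext c
  unfold Datum.addBox
  split_ifs with h <;> rw [mem_vectorDatum_negative] at h <;>
    simp only [Finset.mem_erase, Finset.mem_insert, mem_vectorState] <;> omega

theorem removeBox_vectorState (P : Params) (k : ℤ) :
    (vectorDatum P).removeBox (vectorState k) (k - 1) = vectorState (k - 1) := by
  ext c
  unfold Datum.removeBox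
  split_ifs with h <;> rw [mem_vectorDatum_negative] at h <;>
    simp only [Finset.mem_erase, Finset.mem_insert, mem_vectorState] <;> omega

theorem mem_CC_vectorState (P : Params) (i : ZMod 2) (k b : ℤ) :
    b ∈ (vectorDatum P).CC i (vectorState k) ↔ b = k ∧ i = k := by
  constructor
  · rintro ⟨hc, hn, l, hl⟩
    have h : b = k := by
      rw [mem_vectorDatum_negative, mem_vectorState] at hn
      -- In terms of half-lines, adding a box of either sign adjoins b to {c < k}. The result is
      -- again a half-line only for b = k, as the test points b, k and b - 1 show.
      have hl' : ∀ c, (c < l ↔ c < k ∨ c = b) := by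
        intro c
        have h1 : c ∈ vectorState l ↔ c ∈ (vectorDatum P).addBox (vectorState k) b := by rw [hl]
        unfold Datum.addBox at h1
        split_ifs at h1 with hb <;> rw [mem_vectorDatum_negative] at hb <;>
          simp only [Finset.mem_erase, Finset.mem_insert, mem_vectorState] at h1 <;> omega
      have := hl' b
      have := hl' k
      have := hl' (b - 1)
      omega
    subst h
    exact ⟨rfl, hc.symm⟩
  · rintro ⟨rfl, rfl⟩
    refine ⟨rfl, ?_, b + 1, (addBox_vectorState P b).symm⟩
    rw [mem_vectorDatum_negative, mem_vectorState]
    omega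

theorem mem_CV_vectorState (P : Params) (i : ZMod 2) (k b : ℤ) :
    b ∈ (vectorDatum P).CV i (vectorState k) ↔ b = k - 1 ∧ ¬ i = k := by
  constructor
  · rintro ⟨hc, hn, l, hl⟩
    have h : b = k - 1 := by
      rw [mem_vectorDatum_negative, mem_vectorState] at hn
      -- Dually, removing a box deletes b from {c < k}, which leaves a half-line only for b = k - 1.
      have hl' : ∀ c, (c < l ↔ c < k ∧ c ≠ b) := by
        intro c
        have h1 : c ∈ vectorState l ↔ c ∈ (vectorDatum P).removeBox (vectorState k) b := by rw [hl]
        unfold Datum.removeBox at h1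
        split_ifs at h1 with hb <;> rw [mem_vectorDatum_negative] at hb <;>
          simp only [Finset.mem_erase, Finset.mem_insert, mem_vectorState] at h1 <;> omega
      have := hl' b
      have := hl' (k - 1)
      have := hl' (b + 1)
      omega
    subst h
    refine ⟨rfl, color_eq_sub_one_iff.1 ?_⟩
    rw [← hc]
    simp [vectorDatum]
  · rintro ⟨rfl, hi⟩
    refine ⟨?_, ?_, k - 1, (removeBox_vectorState P k).symm⟩
    · rw [color_eq_sub_one_iff.2 hi]
      simp [vectorDatum]
    · rw [mem_vectorDatum_negative, mem_vectorState]
      omega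

/-- If box k is positive, the state k+1 has the extra factor A⁻¹; if it is negative, the state k has
the extra factor A. Both give the same recursion. -/
theorem weight_vectorState_succ (P : Params) (k : ℤ) (i : ZMod 2) :
    (vectorDatum P).weight P (vectorState (k + 1)) i * affRoot P k (boxPos P k) i =
      (vectorDatum P).weight P (vectorState k) i := by
  by_cases hk : k < 0
  · have h : vectorState k = insert k (vectorState (k + 1)) := by
      ext c
      simp only [Finset.mem_insert, mem_vectorState]
      omega
    have hn : k ∉ vectorState (k + 1) := by
      rw [mem_vectorState]
      omega
    have hb : (vectorDatum P).boxWeight P k i = affRoot P k (boxPos P k) i := by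
      rw [Datum.boxWeight, if_pos ((mem_vectorDatum_negative P k).2 hk), vectorDatum_pos]
      rfl
    rw [Datum.weight, Datum.weight, h, Finset.prod_insert hn, hb]
    ring
  · have h : vectorState (k + 1) = insert k (vectorState k) := by
      ext c
      simp only [Finset.mem_insert, mem_vectorState]
      omega
    have hn : k ∉ vectorState k := by
      rw [mem_vectorState]
      omega
    have hb : (vectorDatum P).boxWeight P k i = (affRoot P k (boxPos P k) i)⁻¹ := by
      rw [Datum.boxWeight, if_neg (mt (mem_vectorDatum_negative P k).1 hk), vectorDatum_pos]
      rfl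
    rw [Datum.weight, Datum.weight, h, Finset.prod_insert hn, hb, mul_left_comm, mul_comm,
      mul_inv_cancel_left₀ (affRoot_ne_zero P _ _ _)]

/-- Both sides satisfy the same first-order recursion in k, so the comparison at k = 0 with Ψ
suffices. Going up divides by A, which is nonzero; going down only multiplies by it. -/
theorem weight_vectorState (P : Params) (k : ℤ) (i : ZMod 2) :
    (vectorDatum P).weight P (vectorState k) i = stateWeight P k i := by
  induction k using Int.induction_on generalizing i with
  | zero =>
    have hq := P.q_ne_zero
    rw [vectorState_zero, Datum.weight, Finset.prod_empty, mul_one, stateWeight]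
    have hb : boxPos P 0 = 1 := by simp [boxPos]
    have hb' : boxPos P (0 - 1) = P.q₁ := by simp [boxPos]
    rw [hb, hb']
    have e0 : P.q⁻¹ * P.q = 1 := inv_mul_cancel₀ hq
    by_cases hi : i = 0
    · subst hi
      simp only [vectorDatum, Pi.mul_apply, Pi.inv_apply, fundWeight, mobius]
      simp [hq]
    · have hi1 : i = 1 := by revert hi; revert i; decide
      subst hi1
      have hX := X_sub_C_ne_zero P.q₁
      have hX' := C_mul_X_sub_C_ne_zero hq (P.q * P.q₁)
      have h5 : RatFunc.C P.q⁻¹ * RatFunc.C P.q = 1 := by rw [← map_mul, e0, map_one]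
      simp only [vectorDatum, Pi.mul_apply, Pi.inv_apply, fundWeight, mobius, if_true, inv_div,
        Int.cast_zero, one_ne_zero, if_false, one_mul]
      rw [div_eq_div_iff hX' hX]
      simp only [map_mul]
      linear_combination -RatFunc.X * (RatFunc.X - RatFunc.C P.q₁) * h5
  | succ k ih =>
    apply mul_right_cancel₀ (affRoot_ne_zero P ((k : ℤ) : ZMod 2) i (boxPos P k))
    rw [weight_vectorState_succ, stateWeight_succ_mul, ih]
  | pred k ih =>
    rw [← weight_vectorState_succ, ← stateWeight_succ_mul, sub_add_cancel, ih]

/-! ### Partial weights and matrix coefficients -/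

/-- The box being added or removed lies at the outer end of the state. In this and the next five
lemmas one partial product is therefore empty, while the other is the full weight of a neighboring
state. -/
theorem weightGT_vectorState_self {P : Params} {k : ℤ} (hk : ¬ k < 0) (i : ZMod 2) :
    (vectorDatum P).weightGT P (vectorState k) k i = 1 := by
  rw [Datum.weightGT, if_neg (mt (mem_vectorDatum_negative P k).1 hk), one_mul,
    Finset.filter_false_of_mem, Finset.prod_empty]
  intro c hc
  rw [mem_vectorState] at hc
  omega

theorem weightLT_vectorState_self {P : Params} {k : ℤ} (hk : k < 0) (i : ZMod 2) :
    (vectorDatum P).weightLT P (vectorState k) k i = 1 := by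
  rw [Datum.weightLT, if_pos ((mem_vectorDatum_negative P k).2 hk), one_mul,
    Finset.filter_false_of_mem, Finset.prod_empty]
  intro c hc
  rw [mem_vectorState] at hc
  omega

theorem weightGT_vectorState_sub_one {P : Params} {k : ℤ} (hk : ¬ k - 1 < 0) (i : ZMod 2) :
    (vectorDatum P).weightGT P (vectorState k) (k - 1) i = 1 := by
  rw [Datum.weightGT, if_neg (mt (mem_vectorDatum_negative P _).1 hk), one_mul,
    Finset.filter_false_of_mem, Finset.prod_empty]
  intro c hc
  rw [mem_vectorState] at hc
  omega

theorem weightLT_vectorState_sub_one {P : Params} {k : ℤ} (hk : k - 1 < 0) (i : ZMod 2) :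
    (vectorDatum P).weightLT P (vectorState k) (k - 1) i = 1 := by
  rw [Datum.weightLT, if_pos ((mem_vectorDatum_negative P _).2 hk), one_mul,
    Finset.filter_false_of_mem, Finset.prod_empty]
  intro c hc
  rw [mem_vectorState] at hc
  omega

theorem weightGT_vectorState_of_neg {P : Params} {k : ℤ} (hk : k < 0) (i : ZMod 2) :
    (vectorDatum P).weightGT P (vectorState k) k i = stateWeight P (k + 1) i := by
  rw [← weight_vectorState, Datum.weightGT, if_pos ((mem_vectorDatum_negative P _).2 hk),
    Datum.weight]
  congr 2
  ext c
  rw [Finset.mem_filter, mem_vectorState, mem_vectorState]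
  omega

theorem weightLT_vectorState_of_nonneg {P : Params} {k : ℤ} (hk : ¬ k - 1 < 0) (i : ZMod 2) :
    (vectorDatum P).weightLT P (vectorState k) (k - 1) i = stateWeight P (k - 1) i := by
  rw [← weight_vectorState, Datum.weightLT, if_neg (mt (mem_vectorDatum_negative P _).1 hk),
    Datum.weight]
  congr 2
  ext c
  rw [Finset.mem_filter, mem_vectorState, mem_vectorState]
  omega

theorem coeffF_vectorState {P : Params} (hP : P.Generic) (k : ℤ) :
    (vectorDatum P).coeffF P k (vectorState k) k = 1 := by
  by_cases hk : k < 0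
  · have hc : ¬ (k : ZMod 2) = ((k + 1 : ℤ) : ZMod 2) := by
      push_cast; exact color_ne_add_one _
    have h0 := hP.q_sub_inv_ne_zero
    rw [Datum.coeffF, if_pos ((mem_vectorDatum_negative P _).2 hk), weightGT_vectorState_of_neg hk,
      vectorDatum_pos, stateWeight, if_neg hc, add_sub_cancel_right,
      logResidue_mobius (boxPos_ne_zero P k), ← neg_sub P.q, neg_mul_neg, inv_mul_cancel₀ h0]
  · rw [Datum.coeffF, if_neg (mt (mem_vectorDatum_negative P _).1 hk),
      weightGT_vectorState_self hk, value_one]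

theorem coeffE_vectorState {P : Params} (hP : P.Generic) (k : ℤ) :
    (vectorDatum P).coeffE P ((k - 1 : ℤ) : ZMod 2) (vectorState k) (k - 1) = 1 := by
  by_cases hk : k - 1 < 0
  · rw [Datum.coeffE, if_pos ((mem_vectorDatum_negative P _).2 hk),
      weightLT_vectorState_sub_one hk, value_one]
  · rw [Datum.coeffE, if_neg (mt (mem_vectorDatum_negative P _).1 hk),
      weightLT_vectorState_of_nonneg hk, vectorDatum_pos, stateWeight, if_pos rfl,
      logResidue_mobius (boxPos_ne_zero P _), inv_mul_cancel₀ hP.q_sub_inv_ne_zero]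

/-! ### Admissibility -/

theorem poles_stateWeight {P : Params} (hP : P.Generic) (k : ℤ) (i : ZMod 2) :
    poles (stateWeight P k i) = {boxPos P (if i = k then k else k - 1)} := by
  unfold stateWeight
  split_ifs
  · exact poles_mobius hP.q_ne_inv (boxPos_ne_zero P _)
  · exact poles_mobius hP.q_ne_inv.symm (boxPos_ne_zero P _)

/-- The poles alone separate the states, but both components are needed: the weights of k and k+1
have the same pole p_k in the color of k. -/
theorem stateWeight_injective {P : Params} (hP : P.Generic) :
    Function.Injective (stateWeight P) := by
  intro k l h
  have e : ∀ i : ZMod 2, (if i = k then k else k - 1) = if i = l then l else l - 1 := by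
    intro i
    apply hP.boxPos_injective
    have := congrArg poles (congrFun h i)
    rwa [poles_stateWeight hP, poles_stateWeight hP, Set.singleton_eq_singleton_iff] at this
  have h1 := e k
  have h2 := e l
  rw [if_pos rfl] at h1
  rw [if_pos rfl] at h2
  split_ifs at h1 h2 <;> omega

theorem isBoxSystem_vectorDatum {P : Params} (hP : P.Generic) :
    (vectorDatum P).IsBoxSystem P where
  box_injective b c h := by
    simp only [vectorDatum, Prod.mk.injEq] at h
    exact_mod_cast h.2.1
  color_eq_of_pos_eq b c h := by
    rw [vectorDatum_pos, vectorDatum_pos] at h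
    rw [hP.boxPos_injective h]
  lex b c l m n hl hm hn := by
    simp only [vectorDatum, sub_zero] at hl hm hn
    norm_cast at hl hm hn
    omega
  color_sub b c l n hl hn := by
    simp only [vectorDatum, sub_zero] at hl hn ⊢
    norm_cast at hl hn
    rw [← hl, ← hn]
    push_cast
    ring

theorem connected_vectorDatum (P : Params) : (vectorDatum P).Connected := by
  rintro _ ⟨k, rfl⟩
  induction k using Int.induction_on with
  | zero => rw [vectorState_zero]
  | succ k ih =>
    refine Relation.ReflTransGen.head ⟨⟨k, rfl⟩, (k : ℤ), ?_, ?_⟩ ih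
    · rw [mem_vectorState]
      omega
    · ext c
      rw [Finset.mem_erase, mem_vectorState, mem_vectorState]
      omega
  | pred k ih =>
    refine Relation.ReflTransGen.head ⟨⟨-k, rfl⟩, (-k - 1 : ℤ), ?_, ?_⟩ ih
    · rw [mem_vectorState]
      omega
    · ext c
      rw [Finset.mem_erase, mem_vectorState, mem_vectorState]
      omega

theorem CC_union_CV_vectorState (P : Params) (i : ZMod 2) (k : ℤ) :
    (vectorDatum P).CC i (vectorState k) ∪ (vectorDatum P).CV i (vectorState k) =
      {if i = k then k else k - 1} := by
  ext b
  rw [Set.mem_union, mem_CC_vectorState, mem_CV_vectorState, Set.mem_singleton_iff]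
  split_ifs with h <;> simp [h]

theorem isAdmissible_vectorDatum {P : Params} (hP : P.Generic) :
    (vectorDatum P).IsAdmissible P where
  boxes := isBoxSystem_vectorDatum hP
  empty_mem := ⟨0, vectorState_zero⟩
  connected := connected_vectorDatum P
  A1 := by
    rintro _ ⟨k, rfl⟩ _ ⟨l, rfl⟩ h
    have : stateWeight P k = stateWeight P l := by
      ext1 i
      rw [← weight_vectorState, ← weight_vectorState, h]
    rw [stateWeight_injective hP this]
  A2 := by
    rintro _ ⟨k, rfl⟩ i
    rw [weight_vectorState, stateWeight]
    have hq := P.q_ne_zero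
    split_ifs
    · exact ⟨balanced_mobius hP.q_ne_inv (boxPos_ne_zero P _) (mul_inv_cancel₀ hq),
        hasSimplePoles_mobius hP.q_ne_inv (boxPos_ne_zero P _)⟩
    · exact ⟨balanced_mobius hP.q_ne_inv.symm (boxPos_ne_zero P _) (inv_mul_cancel₀ hq),
        hasSimplePoles_mobius hP.q_ne_inv.symm (boxPos_ne_zero P _)⟩
  A3 := by
    rintro _ ⟨k, rfl⟩ i
    rw [weight_vectorState, poles_stateWeight hP, CC_union_CV_vectorState, Set.bijOn_singleton,
      vectorDatum_pos]
  A4 := by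
    rintro _ ⟨k, rfl⟩ i b hb
    rw [Set.mem_union, mem_CC_vectorState, mem_CV_vectorState] at hb
    rcases hb with ⟨rfl, -⟩ | ⟨rfl, -⟩
    · refine ⟨fun h => ?_, fun h => ?_⟩
      · rw [weightGT_vectorState_self h]
        exact regularAt_one _
      · rw [weightLT_vectorState_self h]
        exact regularAt_one _
    · refine ⟨fun h => ?_, fun h => ?_⟩
      · rw [weightGT_vectorState_sub_one h]
        exact regularAt_one _
      · rw [weightLT_vectorState_sub_one h]
        exact regularAt_one _
  A5_concave := by
    rintro _ ⟨k, rfl⟩ i j b hb c hc -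
    obtain ⟨rfl, -⟩ := (mem_CC_vectorState P i k b).1 hb
    rw [addBox_vectorState] at hc
    obtain ⟨rfl, -⟩ := (mem_CC_vectorState P j _ c).1 hc
    simp [vectorDatum]
  A5_convex := by
    rintro _ ⟨k, rfl⟩ i j b hb c hc -
    obtain ⟨rfl, -⟩ := (mem_CC_vectorState P i k b).1 hb
    obtain ⟨rfl, -⟩ := (mem_CV_vectorState P j _ c).1 hc
    simp [vectorDatum]

/-! ### Exponentials of formal series -/

theorem coeff_mk_pow_congr {A : Type*} [Ring A] {h h' : ℕ → A} {m : ℕ} (hh : ∀ r < m, h r = h' r) (n : ℕ) :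
    ∀ j < m, PowerSeries.coeff j (PowerSeries.mk h ^ n) =
      PowerSeries.coeff j (PowerSeries.mk h' ^ n) := by
  induction n with
  | zero => simp
  | succ n ih =>
    intro j hj
    rw [pow_succ, pow_succ, PowerSeries.coeff_mul, PowerSeries.coeff_mul]
    refine Finset.sum_congr rfl fun x hx => ?_
    have := Finset.HasAntidiagonal.mem_antidiagonal.1 hx
    rw [ih x.1 (by omega), PowerSeries.coeff_mk, PowerSeries.coeff_mk, hh x.2 (by omega)]

section Exp

variable {A B : Type*} [Ring A] [Algebra ℂ A] [Ring B] [Algebra ℂ B]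

theorem map_expCoeff (φ : A →ₐ[ℂ] B) (h : ℕ → A) (m : ℕ) :
    φ (expCoeff h m) = expCoeff (fun r => φ (h r)) m := by
  simp only [expCoeff, map_sum, map_smul]
  refine Finset.sum_congr rfl fun n _ => ?_
  congr 1
  have h1 : PowerSeries.map (φ : A →+* B) ((PowerSeries.X * PowerSeries.mk h) ^ n) =
      (PowerSeries.X * PowerSeries.mk fun r => φ (h r)) ^ n := by
    rw [map_pow, map_mul, PowerSeries.map_X]
    congr 2
  rw [← h1, PowerSeries.coeff_map, RingHom.coe_coe]

theorem expCoeff_zero (h : ℕ → A) : expCoeff h 0 = 1 := by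
  simp [expCoeff]

/-- Triangularity of the exponential: the coefficient at u^(m+1) contains the last unknown `h m`
only in its linear term, and everything else depends on earlier entries. No commutativity is needed.
-/
theorem expCoeff_succ (h : ℕ → A) (m : ℕ) :
    expCoeff h (m + 1) = h m + expCoeff (fun r => if r < m then h r else 0) (m + 1) := by
  have h1 : ∀ g : ℕ → A, expCoeff g (m + 1) = g m + ∑ n ∈ Finset.range m,
      (((n + 2).factorial : ℂ)⁻¹) •
        PowerSeries.coeff (m + 1) ((PowerSeries.X * PowerSeries.mk g) ^ (n + 2)) := by
    intro g
    rw [expCoeff, Finset.sum_range_succ', Finset.sum_range_succ']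
    simp only [zero_add, pow_zero, pow_one, PowerSeries.coeff_succ_X_mul, PowerSeries.coeff_mk,
      PowerSeries.coeff_one]
    rw [if_neg (by omega), smul_zero, add_zero, add_comm]
    simp
  rw [h1, h1 fun r => if r < m then h r else 0]
  simp only [lt_irrefl, if_false, zero_add]
  congr 1
  refine Finset.sum_congr rfl fun n hn => ?_
  have hn := Finset.mem_range.1 hn
  congr 1
  rw [((PowerSeries.commute_X _).symm).mul_pow, ((PowerSeries.commute_X _).symm).mul_pow,
    PowerSeries.coeff_X_pow_mul', PowerSeries.coeff_X_pow_mul']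
  congr 1
  -- After X^(n+2) is split off, the relevant coefficient has index m + 1 - (n + 2) < m, so the
  -- truncation does not affect it.
  exact coeff_mk_pow_congr (m := m) (fun r hr => by simp [hr]) _ _ (by omega)

/-- By triangularity the exponents are recovered one after another. This is what makes the H
generators determined by the K currents. -/
theorem expCoeff_injective : Function.Injective (expCoeff (A := A)) := by
  intro h h' e
  funext m
  induction m using Nat.strong_induction_on with
  | _ m ih =>
    have h1 := congrFun e (m + 1)
    rw [expCoeff_succ, expCoeff_succ h'] at h1
    have h2 : (fun r => if r < m then h r else 0) = fun r => if r < m then h' r else 0 := by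
      funext r
      split_ifs with hr
      · exact ih r hr
      · rfl
    rw [h2] at h1
    exact add_right_cancel h1

/-- The coefficients of the logarithm of the series `∑ c_m u ^ m` with `c_0 = 1`. -/
def logCoeff (c : ℕ → A) (m : ℕ) : A :=
  c (m + 1) - expCoeff (fun r => if r < m then logCoeff c r else 0) (m + 1)

theorem expCoeff_logCoeff {c : ℕ → A} (hc : c 0 = 1) (m : ℕ) :
    expCoeff (logCoeff c) m = c m := by
  cases m with
  | zero => rw [expCoeff_zero, hc]
  | succ m =>
    rw [expCoeff_succ]
    nth_rewrite 1 [logCoeff]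
    rw [sub_add_cancel]

end Exp

/-! ### Products with the structure functions -/

section StructureFunctions

variable (P : Params)

theorem map_gMul {A B : Type*} [Ring A] [Algebra ℂ A] [Ring B] [Algebra ℂ B] (φ : A →ₐ[ℂ] B)
    (i j : ZMod 2) (f : ℤ → ℤ → A) (k l : ℤ) :
    φ (gMul P i j f k l) = gMul P i j (fun a b => φ (f a b)) k l := by
  unfold gMul
  split_ifs <;> simp

theorem map_gMulSwap {A B : Type*} [Ring A] [Algebra ℂ A] [Ring B] [Algebra ℂ B] (φ : A →ₐ[ℂ] B)
    (i j : ZMod 2) (f : ℤ → ℤ → A) (k l : ℤ) :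
    φ (gMulSwap P i j f k l) = gMulSwap P i j (fun a b => φ (f a b)) k l :=
  map_gMul P φ i j _ l k

variable {V : Type*} [AddCommGroup V] [Module ℂ V]

theorem gMul_apply_eq_zero (i j : ZMod 2) {f : ℤ → ℤ → Module.End ℂ V} {v : V}
    (h : ∀ a b, f a b v = 0) (k l : ℤ) : gMul P i j f k l v = 0 := by
  unfold gMul
  split_ifs <;> simp [h]

/-- The structure function `g_{i,j}(z, p)`. -/
def gFun (i j : ZMod 2) (p : ℂ) : RatFunc ℂ :=
  if i = j then RatFunc.X - RatFunc.C (P.q₂ * p)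
  else (RatFunc.X - RatFunc.C (P.q₁ * p)) * (RatFunc.X - RatFunc.C (P.q₃ * p))

/-- The structure function `g_{i,j}(p, z)`. -/
def gFunSwap (i j : ZMod 2) (p : ℂ) : RatFunc ℂ :=
  if i = j then RatFunc.C p - RatFunc.C P.q₂ * RatFunc.X
  else (RatFunc.C p - RatFunc.C P.q₁ * RatFunc.X) * (RatFunc.C p - RatFunc.C P.q₃ * RatFunc.X)

/-- The hypothesis says that f acts on v as ψ(z) δ(w/p). On the support of the delta function w may
be replaced by p, so a relation of series becomes an identity of rational functions of z. -/
theorem gMul_apply (i j : ZMod 2) {f : ℤ → ℤ → Module.End ℂ V} {v u : V} {p : ℂ} (hp : p ≠ 0)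
    {ε : Bool} {ψ : RatFunc ℂ} (h : ∀ a b, f a b v = (coeffCur ε ψ a * p ^ b) • u) (k l : ℤ) :
    gMul P i j f k l v = (coeffCur ε (gFun P i j p * ψ) k * p ^ l) • u := by
  unfold gMul gFun
  split_ifs
  · have e : (RatFunc.X - RatFunc.C (P.q₂ * p)) * ψ =
        RatFunc.X * ψ + RatFunc.C (-(P.q₂ * p)) * ψ := by
      rw [map_neg]; ring
    rw [e, coeffCur_add, coeffCur_C_mul, coeffCur_X_mul]
    simp only [LinearMap.sub_apply, LinearMap.smul_apply, h, smul_smul, ← sub_smul]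
    congr 1
    rw [zpow_add_one₀ hp]
    ring
  · have e : (RatFunc.X - RatFunc.C (P.q₁ * p)) * (RatFunc.X - RatFunc.C (P.q₃ * p)) * ψ =
        RatFunc.X * (RatFunc.X * ψ) + RatFunc.C (-((P.q₁ + P.q₃) * p)) * (RatFunc.X * ψ) +
          RatFunc.C (P.q₁ * P.q₃ * p ^ 2) * ψ := by
      simp only [map_neg, map_mul, map_add, map_pow]; ring
    rw [e, coeffCur_add, coeffCur_add, coeffCur_C_mul, coeffCur_C_mul, coeffCur_X_mul,
      coeffCur_X_mul, coeffCur_X_mul, add_assoc k]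
    simp only [LinearMap.sub_apply, LinearMap.add_apply, LinearMap.smul_apply, h, smul_smul,
      ← sub_smul, ← add_smul]
    congr 1
    rw [zpow_add_one₀ hp, zpow_add₀ hp l 2]
    norm_cast
    ring_nf

theorem gMulSwap_apply (i j : ZMod 2) {f : ℤ → ℤ → Module.End ℂ V} {v u : V} {p : ℂ}
    (hp : p ≠ 0) {ε : Bool} {ψ : RatFunc ℂ}
    (h : ∀ a b, f a b v = (coeffCur ε ψ a * p ^ b) • u) (k l : ℤ) :
    gMulSwap P i j f k l v = (coeffCur ε (gFunSwap P i j p * ψ) k * p ^ l) • u := by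
  unfold gMulSwap gMul gFunSwap
  split_ifs
  · have e : (RatFunc.C p - RatFunc.C P.q₂ * RatFunc.X) * ψ =
        RatFunc.C p * ψ + RatFunc.C (-P.q₂) * (RatFunc.X * ψ) := by
      rw [map_neg]; ring
    rw [e, coeffCur_add, coeffCur_C_mul, coeffCur_C_mul, coeffCur_X_mul]
    simp only [LinearMap.sub_apply, LinearMap.smul_apply, h, smul_smul, ← sub_smul]
    congr 1
    rw [zpow_add_one₀ hp]
    ring
  · have e : (RatFunc.C p - RatFunc.C P.q₁ * RatFunc.X) *
          (RatFunc.C p - RatFunc.C P.q₃ * RatFunc.X) * ψ =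
        RatFunc.C (P.q₁ * P.q₃) * (RatFunc.X * (RatFunc.X * ψ)) +
          RatFunc.C (-((P.q₁ + P.q₃) * p)) * (RatFunc.X * ψ) + RatFunc.C (p ^ 2) * ψ := by
      simp only [map_neg, map_mul, map_add, map_pow]; ring
    rw [e, coeffCur_add, coeffCur_add, coeffCur_C_mul, coeffCur_C_mul, coeffCur_C_mul,
      coeffCur_X_mul, coeffCur_X_mul, coeffCur_X_mul, add_assoc k]
    simp only [LinearMap.sub_apply, LinearMap.add_apply, LinearMap.smul_apply, h, smul_smul,
      ← sub_smul, ← add_smul]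
    congr 1
    rw [zpow_add_one₀ hp, zpow_add₀ hp l 2]
    norm_cast
    ring_nf

/-- Here f acts as δ(z/(q₁p)) δ(w/p), supported at z = q₁w, where the factor z - q₁w of the
structure function vanishes. -/
theorem gMul_apply_geometric {i j : ZMod 2} (hij : i ≠ j) {f : ℤ → ℤ → Module.End ℂ V} {v u : V}
    {p : ℂ} (hp : p ≠ 0) (h : ∀ a b, f a b v = ((P.q₁ * p) ^ a * p ^ b) • u) (k l : ℤ) :
    gMul P i j f k l v = 0 := by
  have hs := mul_ne_zero P.q₁_ne_zero hp
  rw [gMul, if_neg hij]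
  simp only [LinearMap.sub_apply, LinearMap.add_apply, LinearMap.smul_apply, h, smul_smul,
    ← sub_smul, ← add_smul]
  rw [zpow_add_one₀ hp, zpow_add₀ hp l 2, zpow_add_one₀ hs, zpow_add₀ hs k 2]
  refine smul_eq_zero_of_left ?_ _
  norm_cast
  ring

/-- After extraction of φ_{k+1} this says that A at p_k is, up to sign, the quotient of the
structure functions g(p_k, z) and g(z, p_k). -/
theorem gFun_mul_stateWeight (i : ZMod 2) (k : ℤ) :
    RatFunc.C (colorSign i k) * (gFun P i k (boxPos P k) * stateWeight P k i) +
      gFunSwap P k i (boxPos P k) * stateWeight P (k + 1) i = 0 := by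
  rw [← stateWeight_succ_mul]
  unfold colorSign gFun gFunSwap affRoot
  have h2 := X_sub_C_ne_zero (P.q₂ * boxPos P k)
  have h1 := X_sub_C_ne_zero (P.q₁ * boxPos P k)
  have h3 := X_sub_C_ne_zero (P.q₃ * boxPos P k)
  generalize RatFunc.X - RatFunc.C (P.q₂ * boxPos P k) = u₂ at *
  generalize RatFunc.X - RatFunc.C (P.q₁ * boxPos P k) = u₁ at *
  generalize RatFunc.X - RatFunc.C (P.q₃ * boxPos P k) = u₃ at *
  by_cases h : i = k
  · rw [if_pos h, if_pos h, if_pos h, if_pos h.symm, map_one]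
    field_simp
    ring
  · rw [if_neg h, if_neg h, if_neg h, if_neg (Ne.symm h), map_neg, map_one]
    field_simp
    ring

end StructureFunctions

/-! ### The operators of the vector module -/

section Operators

variable (P : Params)

/-- The labeling of the states of the vector module by the integers. -/
def stateEquiv : ℤ ≃ (vectorDatum P).states := Equiv.ofInjective _ vectorState_injective

/-- The basis of the vector module, labeled by the integers. -/
def vectorBasis : Module.Basis ℤ ℂ (vectorDatum P).Space :=
  (Finsupp.basisSingleOne (ι := (vectorDatum P).states)).reindex (stateEquiv P).symm

theorem ket_vectorState (k : ℤ) : (vectorDatum P).ket (vectorState k) = vectorBasis P k := by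
  rw [vectorBasis, Module.Basis.reindex_apply, Finsupp.coe_basisSingleOne, Equiv.symm_symm]
  exact dif_pos (stateEquiv P k).2

/-- The matrix coefficient `⟨k | E_i(z) | k + 1⟩ = ⟨k + 1 | F_i(z) | k⟩` at `z ^ (-n)`. -/
def stepCoeff (i : ZMod 2) (n k : ℤ) : ℂ := if i = k then boxPos P k ^ n else 0

def opE (i : ZMod 2) (n : ℤ) : Module.End ℂ (vectorDatum P).Space :=
  (vectorBasis P).constr ℂ fun k => stepCoeff P i n (k - 1) • vectorBasis P (k - 1)

def opF (i : ZMod 2) (n : ℤ) : Module.End ℂ (vectorDatum P).Space :=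
  (vectorBasis P).constr ℂ fun k => stepCoeff P i n k • vectorBasis P (k + 1)

def opK (ε : Bool) (i : ZMod 2) (n : ℤ) : Module.End ℂ (vectorDatum P).Space :=
  (vectorBasis P).constr ℂ fun k => coeffCur ε (stateWeight P k i) n • vectorBasis P k

theorem opE_apply (i : ZMod 2) (n k : ℤ) :
    opE P i n (vectorBasis P (k + 1)) = stepCoeff P i n k • vectorBasis P k := by
  rw [opE, Module.Basis.constr_basis, add_sub_cancel_right]

theorem opF_apply (i : ZMod 2) (n k : ℤ) :
    opF P i n (vectorBasis P k) = stepCoeff P i n k • vectorBasis P (k + 1) := by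
  rw [opF, Module.Basis.constr_basis]

theorem opK_apply (ε : Bool) (i : ZMod 2) (n k : ℤ) :
    opK P ε i n (vectorBasis P k) = coeffCur ε (stateWeight P k i) n • vectorBasis P k := by
  rw [opK, Module.Basis.constr_basis]

theorem end_ext {S T : Module.End ℂ (vectorDatum P).Space}
    (h : ∀ k, S (vectorBasis P k) = T (vectorBasis P k)) : S = T :=
  (vectorBasis P).ext h

theorem end_ext_succ {S T : Module.End ℂ (vectorDatum P).Space}
    (h : ∀ k, S (vectorBasis P (k + 1)) = T (vectorBasis P (k + 1))) : S = T :=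
  end_ext P fun k => by simpa using h (k - 1)

theorem coeffCur_stateWeight_zero (ε : Bool) (k : ℤ) (i : ZMod 2) :
    coeffCur ε (stateWeight P k i) 0 =
      if i = k then (if ε then P.q else P.q⁻¹) else (if ε then P.q⁻¹ else P.q) := by
  unfold stateWeight
  cases ε <;> split_ifs <;>
    simp_all [coeffCur_true_mobius, coeffCur_false_mobius, boxPos_ne_zero]

/-- The zero modes are the values of the weight at ∞ and at 0, which are q and q⁻¹ in some order. -/
theorem opK_zero_mul (ε : Bool) (i : ZMod 2) : opK P ε i 0 * opK P (!ε) i 0 = 1 := by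
  have hq := P.q_ne_zero
  refine end_ext P fun k => ?_
  rw [Module.End.mul_apply, opK_apply, map_smul, opK_apply, smul_smul, coeffCur_stateWeight_zero,
    coeffCur_stateWeight_zero, Module.End.one_apply]
  cases ε <;> split_ifs <;> simp_all

theorem opK_true_of_neg (i : ZMod 2) {n : ℤ} (hn : n < 0) : opK P true i n = 0 := by
  refine end_ext P fun k => ?_
  rw [opK_apply, LinearMap.zero_apply]
  refine smul_eq_zero_of_left ?_ _
  unfold stateWeight
  split_ifs <;> rw [coeffCur_true_mobius (boxPos_ne_zero P _), if_pos hn]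

theorem opK_false_of_pos (i : ZMod 2) {n : ℤ} (hn : 0 < n) : opK P false i n = 0 := by
  refine end_ext P fun k => ?_
  rw [opK_apply, LinearMap.zero_apply]
  refine smul_eq_zero_of_left ?_ _
  unfold stateWeight
  split_ifs <;> rw [coeffCur_false_mobius (boxPos_ne_zero P _), if_pos hn]

theorem opK_commute (ε ε' : Bool) (i j : ZMod 2) (k l : ℤ) :
    opK P ε i k * opK P ε' j l = opK P ε' j l * opK P ε i k := by
  refine end_ext P fun m => ?_
  simp only [Module.End.mul_apply, opK_apply, map_smul, smul_smul]
  rw [mul_comm]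

/-- On the basis vector m+1 only the color of m matters. The two orders of the product then differ
in whether K sees φ_m (after the step) or φ_{m+1} (before it). -/
theorem opK_opE (ε : Bool) (i j : ZMod 2) (k l : ℤ) :
    colorSign i j • gMul P i j (fun a b => opK P ε i a * opE P j b) k l
        + gMulSwap P j i (fun a b => opE P j b * opK P ε i a) k l = 0 := by
  refine end_ext_succ P fun m => ?_
  rw [LinearMap.add_apply, LinearMap.smul_apply, LinearMap.zero_apply]
  by_cases h : j = m
  · subst h
    rw [gMul_apply P i m (boxPos_ne_zero P m) (ε := ε) (ψ := stateWeight P m i)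
        (u := vectorBasis P m),
      gMulSwap_apply P m i (boxPos_ne_zero P m) (ε := ε) (ψ := stateWeight P (m + 1) i)
        (u := vectorBasis P m), smul_smul, ← add_smul, ← mul_assoc, ← add_mul, ← coeffCur_C_mul,
      ← coeffCur_add, gFun_mul_stateWeight, coeffCur_zero, zero_mul, zero_smul]
    all_goals
      intro a b
      simp only [Module.End.mul_apply, opE_apply, opK_apply, map_smul, smul_smul, stepCoeff,
        if_true, mul_comm]
  · have hz : ∀ n, stepCoeff P j n m = 0 := fun n => if_neg h
    rw [gMul_apply_eq_zero, gMulSwap, gMul_apply_eq_zero, smul_zero, add_zero] <;>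
      simp [opE_apply, opK_apply, hz]

theorem opK_opF (ε : Bool) (i j : ZMod 2) (k l : ℤ) :
    colorSign i j • gMulSwap P j i (fun a b => opK P ε i a * opF P j b) k l
        + gMul P i j (fun a b => opF P j b * opK P ε i a) k l = 0 := by
  refine end_ext P fun m => ?_
  rw [LinearMap.add_apply, LinearMap.smul_apply, LinearMap.zero_apply]
  by_cases h : j = m
  · subst h
    -- For F the weights φ_m and φ_{m+1} change places and the sign stands at the other term. As the
    -- sign squares to 1, this is the same identity multiplied by the sign.
    have hs : colorSign i m * colorSign i m = 1 := by
      unfold colorSign; split_ifs <;> norm_num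
    rw [gMulSwap_apply P m i (boxPos_ne_zero P m) (ε := ε) (ψ := stateWeight P (m + 1) i)
        (u := vectorBasis P (m + 1)),
      gMul_apply P i m (boxPos_ne_zero P m) (ε := ε) (ψ := stateWeight P m i)
        (u := vectorBasis P (m + 1)), smul_smul, ← add_smul]
    · refine smul_eq_zero_of_left ?_ _
      have h0 := congrArg (fun f => coeffCur ε f k) (gFun_mul_stateWeight P i m)
      simp only [coeffCur_add, coeffCur_C_mul, coeffCur_zero] at h0
      linear_combination colorSign i m * boxPos P m ^ l * h0 -
        coeffCur ε (gFun P i m (boxPos P m) * stateWeight P m i) k * boxPos P m ^ l * hs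
    all_goals
      intro a b
      simp only [Module.End.mul_apply, opF_apply, opK_apply, map_smul, smul_smul, stepCoeff,
        if_true, mul_comm]
  · have hz : ∀ n, stepCoeff P j n m = 0 := fun n => if_neg h
    rw [gMulSwap, gMul_apply_eq_zero, gMul_apply_eq_zero, smul_zero, add_zero] <;>
      simp [opF_apply, opK_apply, hz]

/-- Two downward steps take place at p_{m+1} and then at p_m = q₁p_{m+1}, with different colors. The
product is thus zero or supported on a zero of the structure function, so each term of the quadratic
relation vanishes separately. -/
theorem gMul_opE_opE (i j : ZMod 2) (k l : ℤ) :
    gMul P i j (fun a b => opE P i a * opE P j b) k l = 0 := by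
  refine end_ext_succ P fun m => ?_
  obtain ⟨m, rfl⟩ : ∃ m', m = m' + 1 := ⟨m - 1, by ring⟩
  have hf : ∀ a b, (opE P i a * opE P j b) (vectorBasis P (m + 1 + 1)) =
      (stepCoeff P i a m * stepCoeff P j b (m + 1)) • vectorBasis P m := by
    intro a b
    rw [Module.End.mul_apply, opE_apply, map_smul, opE_apply, smul_smul, mul_comm]
  rw [LinearMap.zero_apply]
  by_cases hi : i = m
  · by_cases hj : j = ((m + 1 : ℤ) : ZMod 2)
    · have hij : i ≠ j := by
        rw [hi, hj]; push_cast; exact color_ne_add_one _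
      refine gMul_apply_geometric P hij (boxPos_ne_zero P (m + 1)) (u := vectorBasis P m) ?_ k l
      intro a b
      rw [hf, stepCoeff, stepCoeff, if_pos hi, if_pos hj, ← boxPos_eq]
    · refine gMul_apply_eq_zero P i j (fun a b => ?_) k l
      rw [hf, stepCoeff, stepCoeff, if_neg hj, mul_zero, zero_smul]
  · refine gMul_apply_eq_zero P i j (fun a b => ?_) k l
    rw [hf, stepCoeff, if_neg hi, zero_mul, zero_smul]

theorem gMul_opF_opF (i j : ZMod 2) (k l : ℤ) :
    gMul P i j (fun a b => opF P j b * opF P i a) k l = 0 := by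
  refine end_ext P fun m => ?_
  have hf : ∀ a b, (opF P j b * opF P i a) (vectorBasis P m) =
      (stepCoeff P i a m * stepCoeff P j b (m + 1)) • vectorBasis P (m + 1 + 1) := by
    intro a b
    rw [Module.End.mul_apply, opF_apply, map_smul, opF_apply, smul_smul]
  rw [LinearMap.zero_apply]
  by_cases hi : i = m
  · by_cases hj : j = ((m + 1 : ℤ) : ZMod 2)
    · have hij : i ≠ j := by
        rw [hi, hj]; push_cast; exact color_ne_add_one _
      refine gMul_apply_geometric P hij (boxPos_ne_zero P (m + 1))
        (u := vectorBasis P (m + 1 + 1)) ?_ k l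
      intro a b
      rw [hf, stepCoeff, stepCoeff, if_pos hi, if_pos hj, ← boxPos_eq]
    · refine gMul_apply_eq_zero P i j (fun a b => ?_) k l
      rw [hf, stepCoeff, stepCoeff, if_neg hj, mul_zero, zero_smul]
  · refine gMul_apply_eq_zero P i j (fun a b => ?_) k l
    rw [hf, stepCoeff, if_neg hi, zero_mul, zero_smul]

theorem opE_mul_opE_self (i : ZMod 2) (a b : ℤ) : opE P i a * opE P i b = 0 := by
  refine end_ext_succ P fun m => ?_
  obtain ⟨m, rfl⟩ : ∃ m', m = m' + 1 := ⟨m - 1, by ring⟩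
  rw [Module.End.mul_apply, opE_apply, map_smul, opE_apply, smul_smul, LinearMap.zero_apply]
  refine smul_eq_zero_of_left ?_ _
  unfold stepCoeff
  push_cast
  simp only [color_eq_add_one_iff]
  split_ifs <;> simp

theorem opF_mul_opF_self (i : ZMod 2) (a b : ℤ) : opF P i a * opF P i b = 0 := by
  refine end_ext P fun m => ?_
  rw [Module.End.mul_apply, opF_apply, map_smul, opF_apply, smul_smul, LinearMap.zero_apply]
  refine smul_eq_zero_of_left ?_ _
  unfold stepCoeff
  push_cast
  simp only [color_eq_add_one_iff]
  split_ifs <;> simp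

variable {P}

/-- On the basis vector m+1 with i = j exactly one product survives: up and back at p_{m+1} if i is
the color of m+1, down and back at p_m otherwise. Its sign agrees with that of α - β in the
corresponding weight. -/
theorem opE_opF_commutator (hP : P.Generic) (i j : ZMod 2) (k l : ℤ) :
    opE P i k * opF P j l - opF P j l * opE P i k =
      if i = j then (P.q - P.q⁻¹)⁻¹ • (opK P true i (k + l) - opK P false i (k + l)) else 0 := by
  have h0 := hP.q_sub_inv_ne_zero
  refine end_ext_succ P fun m => ?_
  have hl : (opE P i k * opF P j l - opF P j l * opE P i k) (vectorBasis P (m + 1)) =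
      (stepCoeff P j l (m + 1) * stepCoeff P i k (m + 1) - stepCoeff P i k m * stepCoeff P j l m) •
        vectorBasis P (m + 1) := by
    rw [LinearMap.sub_apply, Module.End.mul_apply, Module.End.mul_apply, opF_apply, opE_apply,
      map_smul, map_smul, opE_apply, opF_apply, smul_smul, smul_smul, sub_smul]
  rw [hl]
  by_cases hij : i = j
  · subst hij
    rw [if_pos rfl, LinearMap.smul_apply, LinearMap.sub_apply, opK_apply, opK_apply, ← sub_smul,
      smul_smul]
    congr 1
    unfold stepCoeff stateWeight
    by_cases hi : i = m
    · have hi' : ¬ i = ((m + 1 : ℤ) : ZMod 2) := by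
        rw [hi]; push_cast; exact color_ne_add_one _
      rw [if_neg hi', if_neg hi', if_neg hi', if_pos hi, if_pos hi, add_sub_cancel_right,
        coeffCur_mobius_sub (boxPos_ne_zero P m), zpow_add₀ (boxPos_ne_zero P m),
        ← neg_sub P.q, neg_mul, mul_neg, inv_mul_cancel_left₀ h0]
      ring
    · have hi' : i = ((m + 1 : ℤ) : ZMod 2) := by
        push_cast; exact color_eq_add_one_iff.2 hi
      rw [if_pos hi', if_pos hi', if_pos hi', if_neg hi, if_neg hi,
        coeffCur_mobius_sub (boxPos_ne_zero P _), zpow_add₀ (boxPos_ne_zero P _),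
        inv_mul_cancel_left₀ h0]
      ring
  · rw [if_neg hij, LinearMap.zero_apply]
    refine smul_eq_zero_of_left ?_ _
    unfold stepCoeff
    split_ifs <;> simp_all

end Operators

/-! ### The representation -/

section SerreRelations

variable {A : Type*} [Ring A] [Algebra ℂ A]

/-- Any word in three X and one Y has two adjacent X. Hence every monomial vanishes, whatever the
commutator parameters, before symmetrization. -/
theorem map_serre (P : Params) (φ : Free →ₐ[ℂ] A) (X Y : ℤ → Free) (k : Fin 3 → ℤ) (l : ℤ)
    (h : ∀ a b, φ (X a) * φ (X b) = 0) : φ (Free.serre P X Y k l) = 0 := by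
  have h' : ∀ a b c, φ (X a) * (φ (X b) * c) = 0 := fun a b c => by
    rw [← mul_assoc, h, zero_mul]
  unfold Free.serre qComm
  rw [map_smul, map_sum, Finset.sum_eq_zero, smul_zero]
  intro σ _
  simp only [map_sub, map_mul, map_smul, mul_sub, sub_mul, mul_assoc, mul_smul_comm,
    smul_mul_assoc, h, h', mul_zero, smul_zero, sub_zero]

end SerreRelations

section Representation

variable (P : Params)

/-- The operators by which the generators act on the vector module. -/
def genAction : Gen → Module.End ℂ (vectorDatum P).Space
  | .E i k => opE P i k
  | .F i k => opF P i k
  -- The current is first multiplied by the inverse of its zero mode, so that its constant term is 1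
  -- and it has a logarithm. The shift by 1 arises because entry m of `logCoeff` belongs to u^(m+1).
  | .H i r =>
    if 0 < r.1 then
      (P.q - P.q⁻¹)⁻¹ • logCoeff (fun m => opK P false i 0 * opK P true i m) (r.1 - 1).toNat
    else
      (-(P.q - P.q⁻¹))⁻¹ • logCoeff (fun m => opK P true i 0 * opK P false i (-m)) (-r.1 - 1).toNat
  | .K i => opK P true i 0
  | .Kinv i => opK P false i 0
  | .t => 1
  | .tinv => 1

def freeAction : Free →ₐ[ℂ] Module.End ℂ (vectorDatum P).Space :=
  FreeAlgebra.lift ℂ (genAction P)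

theorem freeAction_ι (g : Gen) : freeAction P (FreeAlgebra.ι ℂ g) = genAction P g :=
  FreeAlgebra.lift_ι_apply _ _

theorem freeAction_E (i : ZMod 2) (k : ℤ) : freeAction P (Free.E i k) = opE P i k :=
  freeAction_ι P _

theorem freeAction_F (i : ZMod 2) (k : ℤ) : freeAction P (Free.F i k) = opF P i k :=
  freeAction_ι P _

theorem freeAction_K (i : ZMod 2) : freeAction P (Free.K i) = opK P true i 0 :=
  freeAction_ι P _

theorem freeAction_Kinv (i : ZMod 2) : freeAction P (Free.Kinv i) = opK P false i 0 :=
  freeAction_ι P _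

theorem freeAction_t : freeAction P Free.t = 1 := freeAction_ι P _

theorem freeAction_tinv : freeAction P Free.tinv = 1 := freeAction_ι P _

variable {P}

theorem freeAction_expCoeff (h : ℕ → Free) (m : ℕ) :
    freeAction P (expCoeff h m) = expCoeff (fun r => freeAction P (h r)) m :=
  map_expCoeff (B := Module.End ℂ (vectorDatum P).Space) _ h m

theorem freeAction_gMul (i j : ZMod 2) (f : ℤ → ℤ → Free) (k l : ℤ) :
    freeAction P (gMul P i j f k l) = gMul P i j (fun a b => freeAction P (f a b)) k l :=
  map_gMul (B := Module.End ℂ (vectorDatum P).Space) P _ i j f k l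

theorem freeAction_gMulSwap (i j : ZMod 2) (f : ℤ → ℤ → Free) (k l : ℤ) :
    freeAction P (gMulSwap P i j f k l) = gMulSwap P i j (fun a b => freeAction P (f a b)) k l :=
  map_gMulSwap (B := Module.End ℂ (vectorDatum P).Space) P _ i j f k l

theorem freeAction_Kplus (hP : P.Generic) (i : ZMod 2) (n : ℤ) :
    freeAction P (Free.Kplus P i n) = opK P true i n := by
  unfold Free.Kplus
  split_ifs with hn
  · obtain ⟨m, rfl⟩ : ∃ m : ℕ, n = m := ⟨n.toNat, by omega⟩
    have h : (fun r : ℕ => freeAction P ((P.q - P.q⁻¹) • Free.H i ⟨(r : ℤ) + 1, by omega⟩)) =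
        logCoeff fun m : ℕ => opK P false i 0 * opK P true i m := by
      funext r
      rw [map_smul, Free.H, freeAction_ι, genAction, if_pos (by simp only; omega),
        smul_inv_smul₀ hP.q_sub_inv_ne_zero]
      simp
    rw [map_mul, freeAction_expCoeff, h, freeAction_K, expCoeff_logCoeff (opK_zero_mul P false i),
      ← mul_assoc, show opK P true i 0 * opK P false i 0 = 1 from opK_zero_mul P true i, one_mul,
      Int.toNat_natCast]
  · rw [map_zero, opK_true_of_neg P i (by omega)]

theorem freeAction_Kminus (hP : P.Generic) (i : ZMod 2) (n : ℤ) :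
    freeAction P (Free.Kminus P i n) = opK P false i n := by
  unfold Free.Kminus
  split_ifs with hn
  · obtain ⟨m, rfl⟩ : ∃ m : ℕ, n = -m := ⟨(-n).toNat, by omega⟩
    have h : (fun r : ℕ => freeAction P ((-(P.q - P.q⁻¹)) • Free.H i ⟨-((r : ℤ) + 1), by omega⟩)) =
        logCoeff fun m : ℕ => opK P true i 0 * opK P false i (-m) := by
      funext r
      rw [map_smul, Free.H, freeAction_ι, genAction, if_neg (by simp only; omega),
        smul_inv_smul₀ (neg_ne_zero.2 hP.q_sub_inv_ne_zero)]
      simp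
    have h1 : opK P true i 0 * opK P false i (-((0 : ℕ) : ℤ)) = 1 := by
      simpa using opK_zero_mul P true i
    rw [map_mul, freeAction_expCoeff, h, freeAction_Kinv, expCoeff_logCoeff h1, ← mul_assoc,
      show opK P false i 0 * opK P true i 0 = 1 from opK_zero_mul P false i, one_mul, neg_neg,
      Int.toNat_natCast]
  · rw [map_zero, opK_false_of_pos P i (by omega)]

theorem freeAction_Kcur (hP : P.Generic) (ε : Bool) (i : ZMod 2) (n : ℤ) :
    freeAction P (Free.Kcur P ε i n) = opK P ε i n := by
  cases ε
  · exact freeAction_Kminus hP i n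
  · exact freeAction_Kplus hP i n

theorem freeAction_rel (hP : P.Generic) {a b : Free} (h : Rel P a b) :
    freeAction P a = freeAction P b := by
  cases h with
  | K_mul_Kinv i =>
    rw [map_mul, freeAction_K, freeAction_Kinv, map_one]
    exact opK_zero_mul P true i
  | Kinv_mul_K i =>
    rw [map_mul, freeAction_K, freeAction_Kinv, map_one]
    exact opK_zero_mul P false i
  | t_mul_tinv => rw [map_mul, freeAction_t, freeAction_tinv, map_one, one_mul]
  | tinv_mul_t => rw [map_mul, freeAction_t, freeAction_tinv, map_one, one_mul]
  | t_central g => rw [map_mul, map_mul, freeAction_t, one_mul, mul_one]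
  | KK ε ε' i j k l =>
    rw [map_mul, map_mul, freeAction_Kcur hP, freeAction_Kcur hP]
    exact opK_commute P _ _ _ _ _ _
  | KE ε i j k l =>
    simp only [map_add, map_smul, freeAction_gMul, freeAction_gMulSwap, map_mul, freeAction_Kcur hP,
      freeAction_E, map_zero]
    exact opK_opE P _ _ _ _ _
  | KF ε i j k l =>
    simp only [map_add, map_smul, freeAction_gMul, freeAction_gMulSwap, map_mul, freeAction_Kcur hP,
      freeAction_F, map_zero]
    exact opK_opF P _ _ _ _ _
  | EF i j k l =>
    rw [map_sub, map_mul, map_mul, freeAction_E, freeAction_F, opE_opF_commutator hP,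
      apply_ite (freeAction P), map_smul, map_sub, freeAction_Kplus hP, freeAction_Kminus hP,
      map_zero]
  | EE i j k l =>
    simp only [map_add, map_smul, freeAction_gMul, freeAction_gMulSwap, map_mul, freeAction_E, map_zero]
    rw [gMul_opE_opE, gMulSwap, gMul_opE_opE, smul_zero, add_zero]
  | FF i j k l =>
    simp only [map_add, map_smul, freeAction_gMul, freeAction_gMulSwap, map_mul, freeAction_F, map_zero]
    rw [gMulSwap, gMul_opF_opF, gMul_opF_opF, smul_zero, add_zero]
  | serreE i k l =>
    rw [map_zero]
    refine map_serre (A := Module.End ℂ (vectorDatum P).Space) P _ _ _ k l fun a b => ?_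
    rw [freeAction_E, freeAction_E, opE_mul_opE_self]
  | serreF i k l =>
    rw [map_zero]
    refine map_serre (A := Module.End ℂ (vectorDatum P).Space) P _ _ _ k l fun a b => ?_
    rw [freeAction_F, freeAction_F, opF_mul_opF_self]

/-- The structure map of the vector module. -/
def vectorAction (hP : P.Generic) : Toroidal P →ₐ[ℂ] Module.End ℂ (vectorDatum P).Space :=
  RingQuot.liftAlgHom ℂ ⟨freeAction P, fun _ _ h => freeAction_rel hP h⟩

theorem vectorAction_mk (hP : P.Generic) (a : Free) :
    vectorAction hP (Toroidal.mk P a) = freeAction P a :=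
  RingQuot.liftAlgHom_mkAlgHom_apply ℂ _ _ _

/-- The sums over concave or convex boxes have at most one term, with coefficient 1. Existence,
uniqueness and all properties of the module then refer only to explicit operators on a basis labeled
by ℤ. -/
theorem isAction_iff (hP : P.Generic)
    (ρ : Toroidal P →ₐ[ℂ] Module.End ℂ (vectorDatum P).Space) :
    (vectorDatum P).IsAction P ρ ↔
      (∀ i n, ρ (Toroidal.Kplus P i n) = opK P true i n) ∧
      (∀ i n, ρ (Toroidal.Kminus P i n) = opK P false i n) ∧
      (∀ i n, ρ (Toroidal.F P i n) = opF P i n) ∧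
      (∀ i n, ρ (Toroidal.E P i n) = opE P i n) ∧ ρ (Toroidal.t P) = 1 := by
  have hF : ∀ (i : ZMod 2) (n k : ℤ),
      (∑ᶠ (b : ℤ) (_ : b ∈ (vectorDatum P).CC i (vectorState k)),
        ((vectorDatum P).coeffF P i (vectorState k) b * (vectorDatum P).pos P b ^ n) •
          (vectorDatum P).ket ((vectorDatum P).addBox (vectorState k) b)) =
      opF P i n (vectorBasis P k) := by
    intro i n k
    rw [opF_apply, stepCoeff]
    by_cases h : i = k
    · have hs : (vectorDatum P).CC i (vectorState k) = {k} := by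
        ext b
        rw [mem_CC_vectorState, Set.mem_singleton_iff, and_iff_left h]
      rw [hs, finsum_mem_singleton, h, coeffF_vectorState hP, addBox_vectorState, ket_vectorState,
        vectorDatum_pos, one_mul, if_pos rfl]
    · have hs : (vectorDatum P).CC i (vectorState k) = ∅ := by
        ext b
        rw [mem_CC_vectorState]
        simp [h]
      rw [hs, finsum_mem_empty, if_neg h, zero_smul]
  have hE : ∀ (i : ZMod 2) (n k : ℤ),
      (∑ᶠ (b : ℤ) (_ : b ∈ (vectorDatum P).CV i (vectorState k)),
        ((vectorDatum P).coeffE P i (vectorState k) b * (vectorDatum P).pos P b ^ n) •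
          (vectorDatum P).ket ((vectorDatum P).removeBox (vectorState k) b)) =
      opE P i n (vectorBasis P k) := by
    intro i n k
    have h1 := opE_apply P i n (k - 1)
    rw [sub_add_cancel] at h1
    rw [h1, stepCoeff]
    by_cases h : i = k
    · have hs : (vectorDatum P).CV i (vectorState k) = ∅ := by
        ext b
        rw [mem_CV_vectorState]
        simp [h]
      have h' : ¬ i = ((k - 1 : ℤ) : ZMod 2) := by
        push_cast
        exact fun e => color_eq_sub_one_iff.1 e h
      rw [hs, finsum_mem_empty, if_neg h', zero_smul]
    · have hs : (vectorDatum P).CV i (vectorState k) = {k - 1} := by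
        ext b
        rw [mem_CV_vectorState, Set.mem_singleton_iff, and_iff_left h]
      have h' : i = ((k - 1 : ℤ) : ZMod 2) := by
        push_cast
        exact color_eq_sub_one_iff.2 h
      rw [hs, finsum_mem_singleton, h', coeffE_vectorState hP, removeBox_vectorState,
        ket_vectorState, vectorDatum_pos, one_mul, if_pos rfl]
  constructor
  · intro h
    have hm : ∀ k, vectorState k ∈ (vectorDatum P).states := fun k => ⟨k, rfl⟩
    refine ⟨fun i n => end_ext P fun k => ?_, fun i n => end_ext P fun k => ?_,
      fun i n => end_ext P fun k => ?_, fun i n => end_ext P fun k => ?_, h.t⟩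
    · rw [← ket_vectorState, h.Kplus _ (hm k), ket_vectorState, opK_apply, weight_vectorState]
      rfl
    · rw [← ket_vectorState, h.Kminus _ (hm k), ket_vectorState, opK_apply, weight_vectorState]
      rfl
    · rw [← hF, ← ket_vectorState, h.F _ (hm k)]
    · rw [← hE, ← ket_vectorState, h.E _ (hm k)]
  · rintro ⟨h1, h2, h3, h4, h5⟩
    refine ⟨?_, ?_, ?_, ?_, h5⟩
    · rintro _ ⟨k, rfl⟩ i n
      rw [h1, ket_vectorState, opK_apply, weight_vectorState]
      rfl
    · rintro _ ⟨k, rfl⟩ i n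
      rw [h2, ket_vectorState, opK_apply, weight_vectorState]
      rfl
    · rintro _ ⟨k, rfl⟩ i n
      rw [h3, hF, ket_vectorState]
    · rintro _ ⟨k, rfl⟩ i n
      rw [h4, hE, ket_vectorState]

theorem isAction_vectorAction (hP : P.Generic) :
    (vectorDatum P).IsAction P (vectorAction hP) := by
  refine (isAction_iff hP _).2 ⟨fun i n => ?_, fun i n => ?_, fun i n => ?_, fun i n => ?_, ?_⟩
  · rw [Toroidal.Kplus, vectorAction_mk, freeAction_Kplus hP]
  · rw [Toroidal.Kminus, vectorAction_mk, freeAction_Kminus hP]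
  · rw [Toroidal.F, vectorAction_mk, freeAction_F]
  · rw [Toroidal.E, vectorAction_mk, freeAction_E]
  · rw [Toroidal.t, vectorAction_mk, freeAction_t]

/-! ### Uniqueness -/

/-- A homomorphism from the toroidal algebra is determined by the images of the currents
`K_i^±(z)`, `E_i(z)`, `F_i(z)` and of `t`. -/
theorem toroidal_hom_ext (hP : P.Generic) {A : Type*} [Ring A] [Algebra ℂ A]
    {ρ ρ' : Toroidal P →ₐ[ℂ] A}
    (hp : ∀ i n, ρ (Toroidal.Kplus P i n) = ρ' (Toroidal.Kplus P i n))
    (hm : ∀ i n, ρ (Toroidal.Kminus P i n) = ρ' (Toroidal.Kminus P i n))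
    (hF : ∀ i n, ρ (Toroidal.F P i n) = ρ' (Toroidal.F P i n))
    (hE : ∀ i n, ρ (Toroidal.E P i n) = ρ' (Toroidal.E P i n))
    (ht : ρ (Toroidal.t P) = ρ' (Toroidal.t P)) : ρ = ρ' := by
  let φ : Free →ₐ[ℂ] A := ρ.comp (Toroidal.mk P)
  let φ' : Free →ₐ[ℂ] A := ρ'.comp (Toroidal.mk P)
  have hrel : ∀ (ψ : Toroidal P →ₐ[ℂ] A) {a b : Free}, Rel P a b →
      ψ.comp (Toroidal.mk P) a = ψ.comp (Toroidal.mk P) b := fun ψ a b h =>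
    congrArg ψ (RingQuot.mkAlgHom_rel ℂ h)
  have hK1 : ∀ (ψ : Toroidal P →ₐ[ℂ] A) (i : ZMod 2), ψ.comp (Toroidal.mk P) (Free.K i) *
      ψ.comp (Toroidal.mk P) (Free.Kinv i) = 1 := fun ψ i => by
    rw [← map_mul, hrel ψ (Rel.K_mul_Kinv i), map_one]
  have hK2 : ∀ (ψ : Toroidal P →ₐ[ℂ] A) (i : ZMod 2), ψ.comp (Toroidal.mk P) (Free.Kinv i) *
      ψ.comp (Toroidal.mk P) (Free.K i) = 1 := fun ψ i => by
    rw [← map_mul, hrel ψ (Rel.Kinv_mul_K i), map_one]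
  have hp' : ∀ i n, φ (Free.Kplus P i n) = φ' (Free.Kplus P i n) := hp
  have hm' : ∀ i n, φ (Free.Kminus P i n) = φ' (Free.Kminus P i n) := hm
  -- The generators K_i and K_i⁻¹ are the zero modes of the two currents.
  have hK : ∀ i, φ (Free.K i) = φ' (Free.K i) := fun i => by
    simpa [Free.Kplus, expCoeff_zero] using hp' i 0
  have hKi : ∀ i, φ (Free.Kinv i) = φ' (Free.Kinv i) := fun i => by
    simpa [Free.Kminus, expCoeff_zero] using hm' i 0
  have hs := hP.q_sub_inv_ne_zero
  have hHp : ∀ i (r : ℕ), φ (Free.H i ⟨(r : ℤ) + 1, by omega⟩) =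
      φ' (Free.H i ⟨(r : ℤ) + 1, by omega⟩) := by
    intro i
    have h1 : (fun r : ℕ => φ ((P.q - P.q⁻¹) • Free.H i ⟨(r : ℤ) + 1, by omega⟩)) =
        fun r : ℕ => φ' ((P.q - P.q⁻¹) • Free.H i ⟨(r : ℤ) + 1, by omega⟩) := by
      -- It suffices to compare exponentials, and these are obtained from the currents by cancelling
      -- the invertible zero mode.
      apply expCoeff_injective
      funext m
      have h2 := hp' i m
      rw [Free.Kplus, if_pos (by omega), map_mul, map_mul, ← hK, map_expCoeff, map_expCoeff,
        Int.toNat_natCast] at h2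
      have h3 := congrArg (φ (Free.Kinv i) * ·) h2
      simp only [← mul_assoc] at h3
      rwa [hK2 ρ i, one_mul, one_mul] at h3
    intro r
    have h2 := congrFun h1 r
    simp only [map_smul] at h2
    exact smul_right_injective A hs h2
  have hHm : ∀ i (r : ℕ), φ (Free.H i ⟨-((r : ℤ) + 1), by omega⟩) =
      φ' (Free.H i ⟨-((r : ℤ) + 1), by omega⟩) := by
    intro i
    have h1 : (fun r : ℕ => φ ((-(P.q - P.q⁻¹)) • Free.H i ⟨-((r : ℤ) + 1), by omega⟩)) =
        fun r : ℕ => φ' ((-(P.q - P.q⁻¹)) • Free.H i ⟨-((r : ℤ) + 1), by omega⟩) := by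
      apply expCoeff_injective
      funext m
      have h2 := hm' i (-m)
      rw [Free.Kminus, if_pos (by omega), map_mul, map_mul, ← hKi, map_expCoeff, map_expCoeff,
        neg_neg, Int.toNat_natCast] at h2
      have h3 := congrArg (φ (Free.K i) * ·) h2
      simp only [← mul_assoc] at h3
      rwa [hK1 ρ i, one_mul, one_mul] at h3
    intro r
    have h2 := congrFun h1 r
    simp only [map_smul] at h2
    exact smul_right_injective A (neg_ne_zero.2 hs) h2
  apply RingQuot.ringQuot_ext'
  apply FreeAlgebra.hom_ext
  funext g
  change φ (FreeAlgebra.ι ℂ g) = φ' (FreeAlgebra.ι ℂ g)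
  cases g with
  | E i k => exact hE i k
  | F i k => exact hF i k
  | H i r =>
    obtain ⟨r, hr⟩ := r
    rcases lt_or_gt_of_ne hr with h | h
    · obtain ⟨m, rfl⟩ : ∃ m : ℕ, r = -((m : ℤ) + 1) := ⟨(-r - 1).toNat, by omega⟩
      exact hHm i m
    · obtain ⟨m, rfl⟩ : ∃ m : ℕ, r = (m : ℤ) + 1 := ⟨(r - 1).toNat, by omega⟩
      exact hHp i m
  | K i => exact hK i
  | Kinv i => exact hKi i
  | t => exact ht
  | tinv =>
    -- The image of t⁻¹ is not prescribed; it is determined as the inverse of the image of t.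
    have h1 : φ Free.tinv * φ Free.t = 1 := by
      rw [← map_mul, hrel ρ Rel.tinv_mul_t, map_one]
    have h2 : φ' Free.t * φ' Free.tinv = 1 := by
      rw [← map_mul, hrel ρ' Rel.t_mul_tinv, map_one]
    have h3 : φ Free.t = φ' Free.t := ht
    rw [← h3] at h2
    exact left_inv_eq_right_inv h1 h2

theorem vectorAction_unique (hP : P.Generic)
    {ρ : Toroidal P →ₐ[ℂ] Module.End ℂ (vectorDatum P).Space}
    (h : (vectorDatum P).IsAction P ρ) : ρ = vectorAction hP := by
  obtain ⟨h1, h2, h3, h4, h5⟩ := (isAction_iff hP _).1 h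
  obtain ⟨g1, g2, g3, g4, g5⟩ := (isAction_iff hP _).1 (isAction_vectorAction hP)
  apply toroidal_hom_ext (A := Module.End ℂ (vectorDatum P).Space) hP
  · intro i n; rw [h1, g1]
  · intro i n; rw [h2, g2]
  · intro i n; rw [h3, g3]
  · intro i n; rw [h4, g4]
  · rw [h5, g5]

/-! ### Irreducibility, tameness, and the level -/

/-- Applying T - c_l for the other indices l in the support of v kills those coordinates one by one
and multiplies coordinate k by the nonzero numbers c_k - c_l. What remains is a nonzero multiple of
`b k`. -/
theorem mem_of_diagonal {V ι : Type*} [AddCommGroup V] [Module ℂ V] (b : Module.Basis ι ℂ V)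
    {T : Module.End ℂ V} {c : ι → ℂ} (hc : Function.Injective c) (hT : ∀ k, T (b k) = c k • b k)
    {N : Submodule ℂ V} (hN : ∀ v ∈ N, T v ∈ N) {v : V} (hv : v ∈ N) {k : ι}
    (hk : b.repr v k ≠ 0) : b k ∈ N := by
  classical
  have hcoord : ∀ v j, b.repr (T v) j = c j * b.repr v j := by
    intro v j
    have : (b.coord j).comp T = c j • b.coord j := by
      refine b.ext fun l => ?_
      simp only [LinearMap.comp_apply, LinearMap.smul_apply, hT, map_smul, Module.Basis.coord_apply,
        Module.Basis.repr_self, smul_eq_mul, Finsupp.single_apply]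
      split_ifs with h
      · rw [h]
      · simp
    exact LinearMap.congr_fun this v
  -- The set s bounds the indices other than k at which v may still have a coordinate; the induction
  -- removes them.
  have key : ∀ s : Finset ι, k ∉ s → ∀ v ∈ N, b.repr v k ≠ 0 →
      (∀ j, j ∉ s → j ≠ k → b.repr v j = 0) → b k ∈ N := by
    intro s
    induction s using Finset.induction_on with
    | empty =>
      intro _ v hv hvk h0
      have hv' : v = b.repr v k • b k := by
        refine b.repr.injective (Finsupp.ext fun j => ?_)
        by_cases hj : j = k
        · subst hj; simp
        · rw [h0 j (Finset.notMem_empty j) hj]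
          simp [Ne.symm hj]
      rw [hv'] at hv
      exact (N.smul_mem_iff hvk).1 hv
    | insert l s hl ih =>
      intro hks v hv hvk h0
      have hkl : k ≠ l := fun e => hks (e ▸ Finset.mem_insert_self _ _)
      have hr : ∀ j, b.repr (T v - c l • v) j = (c j - c l) * b.repr v j := by
        intro j
        rw [map_sub, map_smul, Finsupp.sub_apply, Finsupp.smul_apply, hcoord, smul_eq_mul]
        ring
      refine ih (fun h => hks (Finset.mem_insert_of_mem h)) (T v - c l • v)
        (N.sub_mem (hN v hv) (N.smul_mem _ hv)) ?_ ?_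
      · rw [hr]
        exact mul_ne_zero (sub_ne_zero.2 fun e => hkl (hc e)) hvk
      · intro j hj hjk
        rw [hr]
        by_cases hjl : j = l
        · rw [hjl, sub_self, zero_mul]
        · rw [h0 j (by simp [hj, hjl]) hjk, mul_zero]
  refine key ((b.repr v).support.erase k) (Finset.notMem_erase _ _) v hv hk fun j hj hjk => ?_
  by_contra h
  exact hj (Finset.mem_erase.2 ⟨hjk, Finsupp.mem_support_iff.2 h⟩)

/-- Only the summand in the color of m survives, going up to m+1 and back. Mode 1 of F contributes
p_m and mode 0 of E contributes 1, so a single operator separates all basis vectors. -/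
theorem opE_opF_diagonal (m : ℤ) :
    (opE P 0 0 * opF P 0 1 + opE P 1 0 * opF P 1 1) (vectorBasis P m) =
      boxPos P m • vectorBasis P m := by
  rw [LinearMap.add_apply, Module.End.mul_apply, Module.End.mul_apply, opF_apply, opF_apply,
    map_smul, map_smul, opE_apply, opE_apply, smul_smul, smul_smul, ← add_smul]
  congr 1
  unfold stepCoeff
  generalize (m : ZMod 2) = i
  have hi : i = 0 ∨ i = 1 := by revert i; decide
  rcases hi with rfl | rfl <;> simp

theorem eq_top_of_opE_opF_mem (hP : P.Generic) {N : Submodule ℂ (vectorDatum P).Space}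
    (hE : ∀ i n, ∀ v ∈ N, opE P i n v ∈ N) (hF : ∀ i n, ∀ v ∈ N, opF P i n v ∈ N)
    (hN : N ≠ ⊥) : N = ⊤ := by
  obtain ⟨v, hv, hv0⟩ := N.exists_mem_ne_zero_of_ne_bot hN
  obtain ⟨k, hk⟩ : ∃ k, (vectorBasis P).repr v k ≠ 0 := by
    by_contra! h0
    refine hv0 ((vectorBasis P).repr.injective (Finsupp.ext fun j => ?_))
    rw [h0 j, map_zero, Finsupp.zero_apply]
  have hT : ∀ w ∈ N, (opE P 0 0 * opF P 0 1 + opE P 1 0 * opF P 1 1) w ∈ N := by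
    intro w hw
    rw [LinearMap.add_apply, Module.End.mul_apply, Module.End.mul_apply]
    exact Submodule.add_mem _ (hE _ _ _ (hF _ _ _ hw)) (hE _ _ _ (hF _ _ _ hw))
  have hk' : vectorBasis P k ∈ N :=
    mem_of_diagonal (vectorBasis P) hP.boxPos_injective opE_opF_diagonal hT hv hk
  have hup : ∀ m, vectorBasis P m ∈ N → vectorBasis P (m + 1) ∈ N := by
    intro m hm
    have := hF m 0 _ hm
    rwa [opF_apply, stepCoeff, if_pos rfl, zpow_zero, one_smul] at this
  have hdown : ∀ m, vectorBasis P (m + 1) ∈ N → vectorBasis P m ∈ N := by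
    intro m hm
    have := hE m 0 _ hm
    rwa [opE_apply, stepCoeff, if_pos rfl, zpow_zero, one_smul] at this
  have hall : ∀ m, vectorBasis P m ∈ N := by
    intro m
    induction m using Int.inductionOn' (b := k) with
    | zero => exact hk'
    | succ m _ ih => exact hup m ih
    | pred m _ ih => exact hdown _ (by rwa [sub_add_cancel])
  rw [eq_top_iff, ← (vectorBasis P).span_eq, Submodule.span_le]
  rintro _ ⟨m, rfl⟩
  exact hall m

theorem isIrreducible_of_isAction (hP : P.Generic)
    {ρ : Toroidal P →ₐ[ℂ] Module.End ℂ (vectorDatum P).Space}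
    (h : (vectorDatum P).IsAction P ρ) : IsIrreducible ρ := by
  obtain ⟨-, -, hF, hE, -⟩ := (isAction_iff hP _).1 h
  unfold IsIrreducible
  let : Module (Toroidal P) (vectorDatum P).Space := Module.compHom _ ρ.toRingHom
  have hsmul : ∀ (a : Toroidal P) (v : (vectorDatum P).Space), a • v = ρ a v := fun _ _ => rfl
  have : Nontrivial (vectorDatum P).Space :=
    ⟨vectorBasis P 0, 0, (vectorBasis P).ne_zero 0⟩
  rw [isSimpleModule_iff]
  refine { eq_bot_or_eq_top := fun M => ?_ }
  -- A submodule over the algebra is a complex subspace, because the scalars act through the unit of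
  -- the algebra.
  let N : Submodule ℂ (vectorDatum P).Space :=
    { carrier := M
      add_mem' := M.add_mem
      zero_mem' := M.zero_mem
      smul_mem' := fun c v hv => by
        have := M.smul_mem (algebraMap ℂ (Toroidal P) c) hv
        rwa [hsmul, AlgHom.commutes, Module.algebraMap_end_apply] at this }
  have hN : ∀ v, v ∈ N ↔ v ∈ M := fun _ => Iff.rfl
  by_cases hb : N = ⊥
  · left
    ext v
    rw [← hN, hb, Submodule.mem_bot, Submodule.mem_bot]
  · right
    have ht := eq_top_of_opE_opF_mem hP (N := N)
      (fun i n v hv => by rw [← hE, ← hsmul, hN]; exact M.smul_mem _ hv)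
      (fun i n v hv => by rw [← hF, ← hsmul, hN]; exact M.smul_mem _ hv) hb
    ext v
    rw [← hN, ht]
    simp

theorem isTame_of_isAction (hP : P.Generic)
    {ρ : Toroidal P →ₐ[ℂ] Module.End ℂ (vectorDatum P).Space}
    (h : (vectorDatum P).IsAction P ρ) : IsTame ρ := by
  obtain ⟨h1, h2, -⟩ := (isAction_iff hP _).1 h
  refine ⟨ℤ, vectorBasis P, stateWeight P, stateWeight_injective hP, fun k i n => ⟨?_, ?_⟩⟩
  · rw [h1, opK_apply]
    rfl
  · rw [h2, opK_apply]
    rfl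

theorem hasLevel_one_of_isAction (hP : P.Generic)
    {ρ : Toroidal P →ₐ[ℂ] Module.End ℂ (vectorDatum P).Space}
    (h : (vectorDatum P).IsAction P ρ) : HasLevel ρ 1 := by
  obtain ⟨h1, -⟩ := (isAction_iff hP _).1 h
  have hK : ∀ i, Toroidal.K P i = Toroidal.Kplus P i 0 := fun i => by
    simp [Toroidal.K, Toroidal.Kplus, Free.Kplus, expCoeff_zero]
  have hq := P.q_ne_zero
  rw [HasLevel, map_mul, hK, hK, h1, h1, one_smul]
  refine end_ext P fun k => ?_
  rw [Module.End.mul_apply, opK_apply, map_smul, opK_apply, smul_smul, coeffCur_stateWeight_zero,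
    coeffCur_stateWeight_zero, Module.End.one_apply]
  -- On each basis vector one of K₀, K₁ acts by q and the other by q⁻¹, depending only on the parity
  -- of k.
  generalize (k : ZMod 2) = i
  have hi : i = 0 ∨ i = 1 := by revert i; decide
  rcases hi with rfl | rfl <;> simp [hq]

end Representation

end QTor

end

theorem mainTheorem8 (P : QTor.Params) (hP : P.Generic) :
    (QTor.vectorDatum P).IsAdmissible P ∧
    ∃ ρ : QTor.Toroidal P →ₐ[ℂ] Module.End ℂ (QTor.vectorDatum P).Space,
      (QTor.vectorDatum P).IsAction P ρ ∧
      (∀ ρ' : QTor.Toroidal P →ₐ[ℂ] Module.End ℂ (QTor.vectorDatum P).Space,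
        (QTor.vectorDatum P).IsAction P ρ' → ρ' = ρ) ∧
      QTor.IsIrreducible ρ ∧ QTor.IsTame ρ ∧ QTor.HasLevel ρ 1 :=
  have h := QTor.isAction_vectorAction hP
  ⟨QTor.isAdmissible_vectorDatum hP, QTor.vectorAction hP, h,
    fun _ h' => QTor.vectorAction_unique hP h', QTor.isIrreducible_of_isAction hP h,
    QTor.isTame_of_isAction hP h, QTor.hasLevel_one_of_isAction hP h⟩
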